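/- **Setting.** Let $\omega\in\mathbb R$, $\kappa>0$, $\tau\ge 1$ with $\inf_{p\in\mathbb Z}|q\omega-p|>\kappa/|q|^{\tau}$ for all $q\in\mathbb Z\setminus\{0\}$. On $\mathbb T=\mathbb R/\mathbb Z$ put $$c_{\alpha,\beta}(\theta)=\tfrac32+\beta\,\tfrac52\cdot\frac{1}{1+\lambda\,(\cos 2\pi(\theta-\alpha/2)-\cos\pi\alpha)^2},\qquad p(x)=x(1-x),$$ and $\theta_k=\theta_0+k\omega$, $x_{k+1}=c_{\alpha,\beta}(\theta_k)\,p(x_k)$. Write $y_k$ for the orbit of $y_0$ over the same $\theta_0$. Let $C=[\frac13-\frac1{100},\frac13+\frac1{100}]$, $\mathcal A_0=[\omega-\lambda^{-2/5}/2,\ \omega-2\lambda^{-2/3}]$, $I_0=[-\lambda^{-1/7},\lambda^{-1/7}]$, $M_0=\lfloor\lambda^{1/(14\tau)}\rfloor$, $K_0=\lfloor\lambda^{1/(28\tau)}\rfloor$. Intervals are also regarded as arcs of $\mathbb T$. For an arc $I$ let $N(\theta_0;I)$ be the least $N\ge0$ with $\theta_N\in I$, and let $U(I)=(I-\omega)\cup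 I\cup(I+\omega)$. For given intervals $I_i$ and integers $M_i,K_i$ put $$\Theta_{-1}=\mathbb T\setminus(I_0\cup(I_0+\omega)),\quad \Theta_n=\mathbb T\setminus\bigcup_{i=0}^n\bigcup_{m=-M_i}^{M_i}(I_i+m\omega),\quad G_{-1}=\emptyset,\quad G_n=\bigcup_{i=0}^n\bigcup_{m=0}^{3K_i}(I_i+m\omega),$$ $$B_n=\{\beta\in[0,1): M_C(\beta)\le 2K_n-2\},\qquad M_C(\beta)=\max\Big(4,\Big\lceil \frac{\log\frac{1}{150V_\beta(1-V_\beta)}}{\log\frac54}+4\Big\rceil\Big),\quad V_\beta=\tfrac38+\tfrac58\beta .$$ **Sizes$_n$.** $I_0,M_0,K_0$ are as above; $I_0\supset I_1\supset\dots\supset I_n$ are closed intervals; $M_0<\dots<M_n$ and $K_0<\dots<K_n$ are integers; for $1\le k\le n$, $$|I_k|=(4/5)^{K_{k-1}},\quad K_k\in\big[(5/4)^{K_{k-1}/(4\tau)},2(5/4)^{K_{k-1}/(4\tau)}\big],\quad M_k\in\big[(5/4)^{K_{k-1}/(2\tau)},2(5/4)^{K_{k-1}/(2\tau)}\big];$$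 and $I_n\supseteq[\alpha-\omega-(4/5)^{K_n},\ \alpha-\omega+(4/5)^{K_n}]$. **(i)$_n$** For all $\beta\in[0,1]$, $x_0,y_0\in C$, $\theta_0\in\Theta_{n-1}$, with $N=N(\theta_0;I_n)$ and $r_n=\frac12+\frac1{2^{n+1}}$: for any points $\xi_i$ between $x_i$ and $y_i$ ($0\le i<N$), $$\prod_{i=k}^{N-1}|c(\theta_i)p'(\xi_i)|<(3/5)^{r_n(N-k)}\ (0\le k<N),\qquad \prod_{i=0}^{k-1}|c(\theta_i)p'(\xi_i)|<(3/5)^{r_nk}\ (1\le k\le N);$$ if $0\le k\le N$ and $x_k\notin C$, then $\theta_k\in G_{n-1}$; and if $x_0\ne y_0$, then $|x_k-y_k|<(3/5)^{r_nk}|x_0-y_0|$ for $1\le k\le N$. Moreover $\bigcup_{m=0}^{20}(I_n+(2K_n+m)\omega)\subseteq\Theta_{n-1}$ and $I_n-M_n\omega\subseteq\Theta_{n-1}$. **(ii)$_n$** If $\beta\in[0,1]$, $x_0\in[\frac1{100},\frac{99}{100}]$, $\theta_0\notin I_0\cup(I_0+\omega)$, $0\le k\le N(\theta_0;I_n)$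 and $x_k\notin[\frac1{100},\frac{99}{100}]$, then $\theta_k\in G_{n-1}$. **(iii)$_n$** If $\beta\in[0,1]$, $x_0\in C$, $\theta_0\notin I_n$ and $N=N(\theta_0;I_n)$, then $x_N\in C$. For $k\ge1$ call the scale $k$ *standard* if $I_k=[\alpha-\omega-\frac12(4/5)^{K_{k-1}},\ \alpha-\omega+\frac12(4/5)^{K_{k-1}}]$ and $I_k+(2K_k+m)\omega\subseteq\Theta_{k-1}$ for all integers $-1\le m\le 21$. **Proposition.** There is $\lambda_1>0$, depending only on $\omega,\kappa,\tau$, such that for all $\lambda\ge\lambda_1$, all $\alpha\in\mathcal A_0$ and all $n\ge0$ the following holds. Suppose that $I_0,\dots,I_n$, $M_0,\dots,M_n$, $K_0,\dots,K_n$ satisfy Sizes$_n$ and (i)$_n$, (ii)$_n$, (iii)$_n$. Then: 1. There are a closed interval $I_{n+1}\subset I_n$ and integers $M_{n+1},K_{n+1}$ such that Sizes$_{n+1}$ and (i)$_{n+1}$, (ii)$_{n+1}$, (iii)$_{n+1}$ hold, and the scale $n+1$ is standard. 2. If moreover (i)$_k$, (ii)$_k$, (iii)$_k$ hold for all $0\le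 k<n$ and the scales $1,\dots,n$ are standard, then **(iv)$_n$** holds: let $\beta\in B_n$, $x_0\in[\frac1{100},\frac{99}{100}]$, $0\le k\le n$, $\theta_0\in U(I_k)$ and $\theta_0\notin U(I_j)$ for $k<j\le n$; in the case where $k<n$ and $\theta_0\in I_k$, let also $x_0\le\frac25$. Then $\theta_{2K_k+i}\in\Theta_{k-1}$ for all $0\le i\le 20$, and $x_{2K_k+20}\in C$. -/

import Mathlib

open Set

noncomputable section

namespace ForcedLogistic

/-- The Diophantine condition `(DC)_{κ, τ}`: `inf_p |q ω - p| > κ / |q| ^ τ` for all `q ≠ 0`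
(the infimum over the integers `p` is attained). -/
def Diophantine (ω κ τ : ℝ) : Prop :=
  ∀ q : ℤ, q ≠ 0 → ∀ p : ℤ, κ / |(q : ℝ)| ^ τ < |(q : ℝ) * ω - (p : ℝ)|

/-! ### The quasi-periodically forced logistic map -/

/-- The quadratic map `p(x) = x (1 - x)`. -/
def p (x : ℝ) : ℝ := x * (1 - x)

/-- `cos 2π(t - α/2) - cos πα` as a function of the real variable `t`. -/
def gLift (α t : ℝ) : ℝ :=
  Real.cos (2 * Real.pi * (t - α / 2)) - Real.cos (Real.pi * α)

theorem gLift_periodic (α : ℝ) : Function.Periodic (gLift α) 1 := by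
  intro t
  have h : 2 * Real.pi * (t + 1 - α / 2) = 2 * Real.pi * (t - α / 2) + 2 * Real.pi := by ring
  simp only [gLift, h, Real.cos_add_two_pi]

/-- `g(θ, α) = cos 2π(θ - α/2) - cos πα` for `θ` in the circle `𝕋 = ℝ / ℤ`. -/
def g (α : ℝ) : UnitAddCircle → ℝ := (gLift_periodic α).lift

/-- `c_{α, β}(θ) = 3/2 + β (5/2) / (1 + λ g(θ, α)²)`. -/
def c (lam α β : ℝ) (θ : UnitAddCircle) : ℝ :=
  3 / 2 + β * (5 / 2) * (1 / (1 + lam * g α θ ^ 2))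

/-- The map `Φ_{α, β}(θ, x) = (θ + ω, c_{α, β}(θ) p(x))`. -/
def Phi (ω lam α β : ℝ) (z : UnitAddCircle × ℝ) : UnitAddCircle × ℝ :=
  (z.1 + (ω : UnitAddCircle), c lam α β z.1 * p z.2)

/-- `θ_k = θ₀ + k ω`. -/
def angle (ω : ℝ) (θ₀ : UnitAddCircle) (k : ℕ) : UnitAddCircle :=
  θ₀ + k • (ω : UnitAddCircle)

/-- `x_k`, the second coordinate of `Φ_{α, β}^k(θ₀, x₀)`. -/
def fibre (ω lam α β : ℝ) (θ₀ : UnitAddCircle) (x₀ : ℝ) (k : ℕ) : ℝ :=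
  ((Phi ω lam α β)^[k] (θ₀, x₀)).2

/-- `θ_k` is the first coordinate of `Φ_{α, β}^k(θ₀, x₀)`. -/
theorem fst_iterate_Phi (ω lam α β : ℝ) (θ₀ : UnitAddCircle) (x₀ : ℝ) (k : ℕ) :
    ((Phi ω lam α β)^[k] (θ₀, x₀)).1 = angle ω θ₀ k := by
  induction k with
  | zero => simp [angle]
  | succ k ih =>
    rw [Function.iterate_succ_apply']
    simp only [Phi, ih, angle, succ_nsmul, add_assoc]

/-! ### Sets and scales -/

/-- The contracting region `C`. -/
def C : Set ℝ := Icc (1 / 3 - 1 / 100) (1 / 3 + 1 / 100)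

/-- The region `[1/100, 99/100]`. -/
def Mid : Set ℝ := Icc (1 / 100) (99 / 100)

/-- The parameter interval `𝓐₀ = [ω - λ^{-2/5}/2, ω - 2 λ^{-2/3}]`. -/
def A₀ (ω lam : ℝ) : Set ℝ :=
  Icc (ω - lam ^ (-(2 / 5) : ℝ) / 2) (ω - 2 * lam ^ (-(2 / 3) : ℝ))

/-- The data of one scale: the end points of an interval `I`, and the integers `M` and `K`. -/
structure Scale where
  lo : ℝ
  hi : ℝ
  M : ℕ
  K : ℕ

/-- The interval `I` of a scale, on the real line. -/
def Scale.interval (S : Scale) : Set ℝ := Icc S.lo S.hi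

/-- The interval `I` of a scale, as a closed arc of the circle. -/
def Scale.arc (S : Scale) : Set UnitAddCircle := (fun t : ℝ => (t : UnitAddCircle)) '' S.interval

/-- The translate `I + m ω`. -/
def translate (ω : ℝ) (I : Set UnitAddCircle) (m : ℤ) : Set UnitAddCircle :=
  {θ | θ - m • (ω : UnitAddCircle) ∈ I}

/-- The scale zero: `I₀ = [-λ^{-1/7}, λ^{-1/7}]`, `M₀ = [λ^{1/(14τ)}]`, `K₀ = [λ^{1/(28τ)}]`. -/
def scaleZero (τ lam : ℝ) : Scale where
  lo := -lam ^ (-(1 / 7) : ℝ)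
  hi := lam ^ (-(1 / 7) : ℝ)
  M := ⌊lam ^ (1 / (14 * τ))⌋₊
  K := ⌊lam ^ (1 / (28 * τ))⌋₊

/-- `N(θ₀; I)`, the smallest `N ≥ 0` with `θ_N ∈ I`. -/
def hit (ω : ℝ) (θ₀ : UnitAddCircle) (I : Set UnitAddCircle) : ℕ :=
  sInf {k : ℕ | angle ω θ₀ k ∈ I}

/-- `ΘPrev ω s n` is the set `Θ_{n-1}`: for `n = 0` it is `𝕋 \ (I₀ ∪ (I₀ + ω))`, and `Θ_n` is the
complement of the union of the `I_i + m ω` with `0 ≤ i ≤ n` and `-M_i ≤ m ≤ M_i`. -/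
def ΘPrev (ω : ℝ) (s : ℕ → Scale) : ℕ → Set UnitAddCircle
  | 0 => ((s 0).arc ∪ translate ω (s 0).arc 1)ᶜ
  | n + 1 => (⋃ i ∈ Iic n, ⋃ m ∈ Icc (-((s i).M : ℤ)) ((s i).M : ℤ),
      translate ω (s i).arc m)ᶜ

/-- `GPrev ω s n` is the set `G_{n-1}`, the union of the `I_i + m ω` with `0 ≤ i ≤ n - 1` and
`0 ≤ m ≤ 3 K_i`; it is empty for `n = 0`. -/
def GPrev (ω : ℝ) (s : ℕ → Scale) (n : ℕ) : Set UnitAddCircle :=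
  ⋃ i ∈ Iio n, ⋃ m ∈ Icc (0 : ℤ) (3 * ((s i).K : ℤ)), translate ω (s i).arc m

/-- `V_β = 3/8 + (5/8) β`, the largest value of `c_{α, β} · p`. -/
def V (β : ℝ) : ℝ := 3 / 8 + 5 / 8 * β

/-- The return time bound `M_C(β)`: the number `log (1 / (150 V_β (1 - V_β))) / log (5/4) + 4`
rounded up to an integer, and at least `4`. -/
def MC (β : ℝ) : ℕ :=
  max 4 ⌈Real.log (1 / (150 * V β * (1 - V β))) / Real.log (5 / 4) + 4⌉₊

/-- `B_n = {β ∈ [0, 1) : M_C(β) ≤ 2 K_n - 2}`. -/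
def B (s : ℕ → Scale) (n : ℕ) : Set ℝ :=
  {β | β ∈ Ico (0 : ℝ) 1 ∧ (MC β : ℤ) ≤ 2 * ((s n).K : ℤ) - 2}

/-- `(I - ω) ∪ I ∪ (I + ω)`. -/
def nbhd (ω : ℝ) (I : Set UnitAddCircle) : Set UnitAddCircle :=
  translate ω I (-1) ∪ I ∪ translate ω I 1

/-- The prescribed sizes and nesting of the scales `0, …, n`. -/
structure Sizes (ω τ lam α : ℝ) (s : ℕ → Scale) (n : ℕ) : Prop where
  zero : s 0 = scaleZero τ lam
  nested : ∀ k < n, (s (k + 1)).interval ⊆ (s k).interval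
  M_lt : ∀ k < n, (s k).M < (s (k + 1)).M
  K_lt : ∀ k < n, (s k).K < (s (k + 1)).K
  length : ∀ k < n, (s (k + 1)).hi - (s (k + 1)).lo = (4 / 5 : ℝ) ^ (s k).K
  K_mem : ∀ k < n, ((s (k + 1)).K : ℝ) ∈
    Icc ((5 / 4 : ℝ) ^ ((s k).K / (4 * τ))) (2 * (5 / 4 : ℝ) ^ ((s k).K / (4 * τ)))
  M_mem : ∀ k < n, ((s (k + 1)).M : ℝ) ∈
    Icc ((5 / 4 : ℝ) ^ ((s k).K / (2 * τ))) (2 * (5 / 4 : ℝ) ^ ((s k).K / (2 * τ)))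
  centre : Icc (α - ω - (4 / 5 : ℝ) ^ (s n).K) (α - ω + (4 / 5 : ℝ) ^ (s n).K) ⊆ (s n).interval

/-- The contraction exponent `1/2 + 1/2^{n+1}`. -/
def rate (n : ℕ) : ℝ := 1 / 2 + 1 / 2 ^ (n + 1)

/-! ### The properties (i)–(iv) -/

/-- The part of property (i) that concerns orbits started in `C` over `Θ_{n-1}`. -/
def Contraction (ω lam α : ℝ) (s : ℕ → Scale) (n : ℕ) : Prop :=
  ∀ β ∈ Icc (0 : ℝ) 1, ∀ x₀ ∈ C, ∀ y₀ ∈ C, ∀ θ₀ ∈ ΘPrev ω s n, ∀ N : ℕ,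
    N = hit ω θ₀ (s n).arc →
    (∀ ξ : ℕ → ℝ,
      (∀ i < N, ξ i ∈ segment ℝ (fibre ω lam α β θ₀ x₀ i) (fibre ω lam α β θ₀ y₀ i)) →
        (∀ k < N, ∏ i ∈ Finset.Ico k N, |c lam α β (angle ω θ₀ i) * deriv p (ξ i)|
          < (3 / 5 : ℝ) ^ (rate n * ((N : ℝ) - k))) ∧
        (∀ k ∈ Icc 1 N, ∏ i ∈ Finset.range k, |c lam α β (angle ω θ₀ i) * deriv p (ξ i)|
          < (3 / 5 : ℝ) ^ (rate n * (k : ℝ)))) ∧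
    (∀ k ≤ N, fibre ω lam α β θ₀ x₀ k ∉ C → angle ω θ₀ k ∈ GPrev ω s n) ∧
    (x₀ ≠ y₀ → ∀ k ∈ Icc 1 N, |fibre ω lam α β θ₀ x₀ k - fibre ω lam α β θ₀ y₀ k|
      < (3 / 5 : ℝ) ^ (rate n * (k : ℝ)) * |x₀ - y₀|)

/-- The part of property (i) that concerns the translates of `I_n`. -/
def Return (ω : ℝ) (s : ℕ → Scale) (n : ℕ) : Prop :=
  (∀ m ∈ Icc (0 : ℤ) 20, translate ω (s n).arc (2 * ((s n).K : ℤ) + m) ⊆ ΘPrev ω s n) ∧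
  translate ω (s n).arc (-((s n).M : ℤ)) ⊆ ΘPrev ω s n

/-- Property (i). -/
def PropI (ω lam α : ℝ) (s : ℕ → Scale) (n : ℕ) : Prop :=
  Contraction ω lam α s n ∧ Return ω s n

/-- Property (ii). -/
def PropII (ω lam α : ℝ) (s : ℕ → Scale) (n : ℕ) : Prop :=
  ∀ β ∈ Icc (0 : ℝ) 1, ∀ x₀ ∈ Mid, ∀ θ₀ ∉ (s 0).arc ∪ translate ω (s 0).arc 1,
    ∀ k ≤ hit ω θ₀ (s n).arc,
      fibre ω lam α β θ₀ x₀ k ∉ Mid → angle ω θ₀ k ∈ GPrev ω s n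

/-- Property (iii). -/
def PropIII (ω lam α : ℝ) (s : ℕ → Scale) (n : ℕ) : Prop :=
  ∀ β ∈ Icc (0 : ℝ) 1, ∀ x₀ ∈ C, ∀ θ₀ ∉ (s n).arc,
    fibre ω lam α β θ₀ x₀ (hit ω θ₀ (s n).arc) ∈ C

/-- Properties (i), (ii) and (iii) at the scale `n`. -/
structure PropsIToIII (ω lam α : ℝ) (s : ℕ → Scale) (n : ℕ) : Prop where
  i : PropI ω lam α s n
  ii : PropII ω lam α s n
  iii : PropIII ω lam α s n

/-- The scale `n + 1` is standard: `I_{n+1}` is centred at `α - ω`, and it has the return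
property with one more translate at either end. -/
structure IsStandardSucc (ω α : ℝ) (s : ℕ → Scale) (n : ℕ) : Prop where
  lo_eq : (s (n + 1)).lo = α - ω - (4 / 5 : ℝ) ^ (s n).K / 2
  hi_eq : (s (n + 1)).hi = α - ω + (4 / 5 : ℝ) ^ (s n).K / 2
  wide : ∀ m ∈ Icc (-1 : ℤ) 21,
    translate ω (s (n + 1)).arc (2 * ((s (n + 1)).K : ℤ) + m) ⊆ ΘPrev ω s (n + 1)

/-- Property (iv). -/
def PropIV (ω lam α : ℝ) (s : ℕ → Scale) (n : ℕ) : Prop :=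
  ∀ β ∈ B s n, ∀ x₀ ∈ Mid, ∀ k ≤ n, ∀ θ₀ ∈ nbhd ω (s k).arc,
    (∀ j, k < j → j ≤ n → θ₀ ∉ nbhd ω (s j).arc) →
    (k < n → θ₀ ∈ (s k).arc → x₀ ≤ 2 / 5) →
      (∀ i ≤ 20, angle ω θ₀ (2 * (s k).K + i) ∈ ΘPrev ω s k) ∧
      fibre ω lam α β θ₀ x₀ (2 * (s k).K + 20) ∈ C

end ForcedLogistic

end

open ForcedLogistic

namespace ForcedLogistic

/-! ### Orbits of the rotation and of the skew product -/

section Orbits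

variable {ω lam α β : ℝ} {θ : UnitAddCircle} {x : ℝ} {I J : Set UnitAddCircle}

/-! The factorisation g = -2 sin(πθ) sin(π(θ-α)) puts the peaks of c at 0 and α. Since α is close to
ω, they lie in `I₀` and `I₀ + ω`. Elsewhere c is nearly 3/2, so the fibre map has an attracting
fixed point near 1/3 and sends `Mid` into `C` within twenty steps (`mem_C_of_twenty`). Only visits
to I_n followed by I_n + ω can do harm.

The mechanism is recovery after a visit to I_n \ I_{n+1}. The interval I_{n+1} is centred at α - ω,
so over I_n + ω the orbit stays at distance at least (4/5)^{K_n}/2 from the peak α, and c falls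
short of 4 by a quantity of order (4/5)^{2K_n}. The point x is then at worst that close to 1, hence
next that close to 0. Near 0 it grows by 5/4 per step, so it is back in `Mid` before time 2K_n.
Property (ii) at scale n keeps it in `Mid` at time 2K_n, because Θ_{n-1} misses G_{n-1}. Twenty more
steps lead into C (`Setting.fibre_mem_C_of_passage`).

An orbit up to its first visit to I_{n+1} thus alternates between stretches governed by scale n and
passages of length 2K_n + 20. Strong induction on the length gives (ii) and (iii) at scale n + 1.
For (i), each good stretch has length at least M_n, which is at least K_n²/4. Lowering the exponent
from r_n to r_{n+1} frees enough contraction on it to pay for an adjacent passage (`Chain`,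
`pow_rateRatio_mul_le`).

The new integers come from the Diophantine condition: short windows of times contain runs during
which the new interval avoids all old translates (`Setting.exists_avoids`). Property (iv) is the
same recovery argument, with the distance to the peak read off from scale k + 1 if k < n, and from β
∈ B_n if k = n. -/

@[simp] theorem angle_zero : angle ω θ 0 = θ := by simp [angle]

theorem angle_add (j k : ℕ) : angle ω θ (j + k) = angle ω (angle ω θ j) k := by
  simp only [angle, add_nsmul, add_assoc]

@[simp] theorem fibre_zero : fibre ω lam α β θ x 0 = x := rfl

theorem fibre_succ (k : ℕ) : fibre ω lam α β θ x (k + 1) =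
    c lam α β (angle ω θ k) * p (fibre ω lam α β θ x k) := by
  simp only [fibre, Function.iterate_succ_apply', ← fst_iterate_Phi ω lam α β θ x k]
  rfl

theorem fibre_one : fibre ω lam α β θ x 1 = c lam α β θ * p x := by
  rw [fibre_succ, angle_zero, fibre_zero]

theorem fibre_add (j k : ℕ) : fibre ω lam α β θ x (j + k) =
    fibre ω lam α β (angle ω θ j) (fibre ω lam α β θ x j) k := by
  induction k with
  | zero => simp
  | succ k ih => rw [← add_assoc, fibre_succ, ih, angle_add, fibre_succ]

theorem mem_translate {m : ℤ} : θ ∈ translate ω I m ↔ θ - m • (ω : UnitAddCircle) ∈ I := Iff.rfl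

@[simp] theorem translate_zero : translate ω I 0 = I := by
  ext θ; simp [mem_translate]

theorem angle_mem_translate {k : ℕ} {m : ℤ} :
    angle ω θ k ∈ translate ω I m ↔ θ ∈ translate ω I (m - k) := by
  have h : θ + k • (ω : UnitAddCircle) - m • (ω : UnitAddCircle)
      = θ - (m - k) • (ω : UnitAddCircle) := by
    rw [sub_smul, natCast_zsmul]; abel
  rw [mem_translate, mem_translate, angle, h]

theorem angle_mem_iff {k : ℕ} : angle ω θ k ∈ I ↔ θ ∈ translate ω I (-k) := by
  rw [← translate_zero (ω := ω) (I := I), angle_mem_translate]; simp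

theorem angle_mem_translate_of_mem {k : ℕ} {m : ℤ} (h : θ ∈ translate ω I m) :
    angle ω θ k ∈ translate ω I (m + k) := by
  rw [angle_mem_translate]; simpa using h

theorem mem_translate_arc {S : Scale} {m : ℤ} : θ ∈ translate ω S.arc m ↔
    ∃ t ∈ S.interval, ((t + m * ω : ℝ) : UnitAddCircle) = θ := by
  have h : (m • (ω : UnitAddCircle)) = ((m * ω : ℝ) : UnitAddCircle) := by
    rw [← AddCircle.coe_zsmul, zsmul_eq_mul]
  constructor
  · rintro ⟨t, ht, hθ⟩
    refine ⟨t, ht, ?_⟩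
    simp only at hθ
    rw [AddCircle.coe_add, hθ, h, sub_add_cancel]
  · rintro ⟨t, ht, rfl⟩
    refine ⟨t, ht, ?_⟩
    simp only
    rw [AddCircle.coe_add, h, add_sub_cancel_right]

theorem arc_mono {S T : Scale} (h : S.interval ⊆ T.interval) : S.arc ⊆ T.arc :=
  image_mono h

end Orbits

/-! ### Return times -/

section Return

variable {ω κ τ : ℝ} {θ : UnitAddCircle} {S T : Scale}

/-- Multiples of `ω` of order at most `R` are further from the integers than twice the length of
the interval of `S`. -/
def GapBound (ω : ℝ) (S : Scale) (R : ℤ) : Prop :=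
  ∀ q p : ℤ, q ≠ 0 → |q| ≤ R → 2 * (S.hi - S.lo) < |(q : ℝ) * ω - p|

theorem exists_int_of_mem_translate {m m' : ℤ} (hST : T.interval ⊆ S.interval)
    (h : θ ∈ translate ω S.arc m) (h' : θ ∈ translate ω T.arc m') :
    ∃ r : ℤ, |((m - m' : ℤ) : ℝ) * ω - r| ≤ S.hi - S.lo := by
  obtain ⟨t, ht, rfl⟩ := mem_translate_arc.1 h
  obtain ⟨t', ht', h2⟩ := mem_translate_arc.1 h'
  have h3 : ((t' + m' * ω - (t + m * ω) : ℝ) : UnitAddCircle) = 0 := by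
    rw [AddCircle.coe_sub, h2, sub_self]
  obtain ⟨r, hr⟩ := (AddCircle.coe_eq_zero_iff 1).1 h3
  refine ⟨-r, ?_⟩
  have hr' : (r : ℝ) = t' + m' * ω - (t + m * ω) := by simpa using hr
  have h4 := hST ht'
  have h5 : ((m - m' : ℤ) : ℝ) * ω - ((-r : ℤ) : ℝ) = t' - t := by push_cast; rw [hr']; ring
  rw [h5, abs_le]
  simp only [Scale.interval, mem_Icc] at ht h4
  constructor <;> linarith [ht.1, ht.2, h4.1, h4.2]

theorem GapBound.eq_of_mem {R m m' : ℤ} (hS : GapBound ω S R) (hST : T.interval ⊆ S.interval)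
    (h : θ ∈ translate ω S.arc m) (h' : θ ∈ translate ω T.arc m') (hR : |m - m'| ≤ R) :
    m = m' := by
  obtain ⟨r, hr⟩ := exists_int_of_mem_translate hST h h'
  by_contra hne
  have := hS (m - m') r (sub_ne_zero.2 hne) hR
  have h0 := abs_nonneg (((m - m' : ℤ) : ℝ) * ω - r)
  linarith

theorem Diophantine.irrational (hκ : 0 < κ) (hω : Diophantine ω κ τ) : Irrational ω := by
  rintro ⟨q, rfl⟩
  have hd : (q.den : ℤ) ≠ 0 := by exact_mod_cast q.den_nz
  have h := hω q.den hd q.num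
  have h2 : ((q.den : ℤ) : ℝ) * (q : ℝ) - (q.num : ℝ) = 0 := by
    have := Rat.den_mul_eq_num q
    have h3 : ((q.den : ℚ) * q : ℚ) = q.num := this
    have h4 : ((q.den : ℝ) * (q : ℝ)) = (q.num : ℝ) := by exact_mod_cast h3
    push_cast
    linarith
  rw [h2, abs_zero] at h
  have : 0 ≤ κ / |((q.den : ℤ) : ℝ)| ^ τ := by positivity
  linarith

theorem exists_angle_mem (hω : Irrational ω) (hS : S.lo < S.hi) (θ : UnitAddCircle) :
    ∃ k : ℕ, angle ω θ k ∈ S.arc := by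
  have hd : DenseRange (· • (ω : UnitAddCircle) : ℕ → UnitAddCircle) := by
    -- On the circle the forward orbit is dense as soon as the two-sided one is.
    rw [← denseRange_zsmul_iff_nsmul, AddCircle.denseRange_zsmul_coe_iff, div_one]
    exact hω
  have hopen : IsOpen ((fun t : ℝ => (t : UnitAddCircle)) '' Ioo S.lo S.hi) :=
    QuotientAddGroup.isOpenMap_coe _ isOpen_Ioo
  have hopen2 : IsOpen ((fun z => θ + z) ⁻¹'
      ((fun t : ℝ => (t : UnitAddCircle)) '' Ioo S.lo S.hi)) :=
    hopen.preimage (by fun_prop)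
  have hne : ((fun z => θ + z) ⁻¹'
      ((fun t : ℝ => (t : UnitAddCircle)) '' Ioo S.lo S.hi)).Nonempty := by
    obtain ⟨t, ht⟩ := nonempty_Ioo.2 hS
    exact ⟨-θ + t, t, ht, by simp⟩
  obtain ⟨k, hk⟩ := hd.exists_mem_open hopen2 hne
  obtain ⟨t, ht, h⟩ := hk
  exact ⟨k, t, Ioo_subset_Icc_self ht, h⟩

theorem angle_hit_mem {I : Set UnitAddCircle} (h : ∃ k : ℕ, angle ω θ k ∈ I) :
    angle ω θ (hit ω θ I) ∈ I :=
  Nat.sInf_mem (s := {k : ℕ | angle ω θ k ∈ I}) h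

theorem angle_notMem_of_lt_hit {I : Set UnitAddCircle} {k : ℕ} (h : k < hit ω θ I) :
    angle ω θ k ∉ I :=
  fun hk => Nat.notMem_of_lt_sInf h hk

/-- Existence of a visit must be assumed, because `hit` takes the default value 0 on an orbit that
never meets `I`. -/
theorem le_hit {I : Set UnitAddCircle} (h : ∃ k : ℕ, angle ω θ k ∈ I) {k : ℕ}
    (hk : ∀ j < k, angle ω θ j ∉ I) : k ≤ hit ω θ I :=
  not_lt.1 fun hlt => hk _ hlt (angle_hit_mem h)

theorem hit_le {I : Set UnitAddCircle} {k : ℕ} (h : angle ω θ k ∈ I) : hit ω θ I ≤ k :=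
  Nat.sInf_le h

end Return

/-! ### Elementary estimates on the forcing and on the quadratic map -/

section Estimates

variable {ω κ lam α β : ℝ} {θ : UnitAddCircle} {x y a b : ℝ}

theorem g_coe (t : ℝ) : g α (t : UnitAddCircle) = gLift α t := rfl

/-- The product form separates the two peaks, at 0 and at α modulo 1, so that each factor can be
bounded below on its own. -/
theorem gLift_eq (t : ℝ) :
    gLift α t = -2 * Real.sin (Real.pi * t) * Real.sin (Real.pi * (t - α)) := by
  rw [gLift, Real.cos_sub_cos]
  congr 3 <;> ring_nf

theorem two_mul_abs_le_abs_sin {t : ℝ} (ht : |t| ≤ 1 / 2) :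
    2 * |t| ≤ |Real.sin (Real.pi * t)| := by
  have hpi := Real.pi_pos
  have h := Real.mul_abs_le_abs_sin (x := Real.pi * t) (by
    rw [abs_mul, abs_of_pos hpi]; nlinarith)
  rw [abs_mul, abs_of_pos hpi, ← mul_assoc, div_mul_cancel₀ _ hpi.ne'] at h
  exact h

theorem abs_sin_pi_mul_sub_int (t : ℝ) (n : ℤ) :
    |Real.sin (Real.pi * (t - n))| = |Real.sin (Real.pi * t)| := by
  rw [mul_sub, mul_comm Real.pi (n : ℝ), Real.sin_sub_int_mul_pi, abs_mul, abs_neg_one_zpow,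
    one_mul]

theorem c_lower (hl : 0 ≤ lam) (hβ : β ∈ Icc (0 : ℝ) 1) : 3 / 2 ≤ c lam α β θ := by
  have := hβ.1
  have h : 0 ≤ β * (5 / 2) * (1 / (1 + lam * g α θ ^ 2)) := by positivity
  rw [c]; linarith

theorem c_le_V (hl : 0 ≤ lam) (hβ : β ∈ Icc (0 : ℝ) 1) : c lam α β θ ≤ 4 * V β := by
  have h1 : 1 / (1 + lam * g α θ ^ 2) ≤ 1 := by
    rw [div_le_one (by positivity)]; nlinarith [mul_nonneg hl (sq_nonneg (g α θ))]
  have := hβ.1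
  rw [c, V]; nlinarith

theorem V_le_one (hβ : β ∈ Icc (0 : ℝ) 1) : V β ≤ 1 := by rw [V]; linarith [hβ.2]

theorem c_le_four (hl : 0 ≤ lam) (hβ : β ∈ Icc (0 : ℝ) 1) : c lam α β θ ≤ 4 :=
  (c_le_V hl hβ).trans (by linarith [V_le_one hβ])

theorem c_le_of_le {u : ℝ} (hu : 0 ≤ u) (hβ : β ∈ Icc (0 : ℝ) 1) (h : u ≤ lam * g α θ ^ 2) :
    c lam α β θ ≤ 3 / 2 + 5 / 2 * (1 / (1 + u)) := by
  have h1 : 1 / (1 + lam * g α θ ^ 2) ≤ 1 / (1 + u) :=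
    one_div_le_one_div_of_le (by linarith) (by linarith)
  have h2 : 0 ≤ 1 / (1 + lam * g α θ ^ 2) := by
    apply one_div_nonneg.2; linarith
  have := hβ.1
  have := hβ.2
  rw [c]; nlinarith

theorem p_le_quarter : p x ≤ 1 / 4 := by rw [p]; nlinarith [sq_nonneg (x - 1 / 2)]

theorem p_nonneg (hx : x ∈ Icc (0 : ℝ) 1) : 0 ≤ p x :=
  mul_nonneg hx.1 (by linarith [hx.2])

theorem min_p_le (h : x ∈ Icc a b) : min (p a) (p b) ≤ p x := by
  obtain ⟨h1, h2⟩ := h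
  simp only [p]
  rcases le_total (x + a) 1 with h3 | h3
  · exact min_le_of_left_le (by nlinarith)
  · exact min_le_of_right_le (by nlinarith)

theorem mid_subset : Mid ⊆ Icc (0 : ℝ) 1 := Icc_subset_Icc (by norm_num) (by norm_num)

theorem C_subset_mid : C ⊆ Mid := Icc_subset_Icc (by norm_num) (by norm_num)

theorem p_lower_of_mem_mid (hx : x ∈ Mid) : 99 / 10000 ≤ p x := by
  have := min_p_le hx
  norm_num [p] at this ⊢
  exact this

theorem c_mul_p_mem (hl : 0 ≤ lam) (hβ : β ∈ Icc (0 : ℝ) 1) (hx : x ∈ Icc (0 : ℝ) 1) :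
    c lam α β θ * p x ∈ Icc (0 : ℝ) 1 := by
  have h1 := c_lower (α := α) (θ := θ) hl hβ
  have h2 := c_le_four (α := α) (θ := θ) hl hβ
  have h3 := p_nonneg hx
  have h4 := p_le_quarter (x := x)
  exact ⟨by positivity, by nlinarith⟩

theorem fibre_mem (hl : 0 ≤ lam) (hβ : β ∈ Icc (0 : ℝ) 1) (hx : x ∈ Icc (0 : ℝ) 1) (k : ℕ) :
    fibre ω lam α β θ x k ∈ Icc (0 : ℝ) 1 := by
  induction k with
  | zero => exact hx
  | succ k ih => rw [fibre_succ]; exact c_mul_p_mem hl hβ ih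

/-- Away from the peaks the forcing constant is close to `3/2`. -/
theorem c_le_of_outside {h : ℝ} (hl : 0 ≤ lam) (h0 : 0 < h) (hα : |α - ω| ≤ h / 2)
    (hlam : 2500 ≤ 4 * lam * h ^ 4) {S : Scale} (hlo : S.lo = -h) (hhi : S.hi = h)
    (hβ : β ∈ Icc (0 : ℝ) 1) (hθ : θ ∉ S.arc ∪ translate ω S.arc 1) :
    c lam α β θ ≤ 3 / 2 + 1 / 1000 := by
  obtain ⟨t, rfl⟩ := QuotientAddGroup.mk_surjective θ
  -- `I₀` contains the h/2-neighbourhood of 0, and `I₀ + ω` that of α because |α - ω| ≤ h/2. Outside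
  -- both, each sine is at least h, hence |g| ≥ 2h².
  have key : ∀ t : ℝ, (∀ n : ℤ, h / 2 < |t - n|) → h ≤ |Real.sin (Real.pi * t)| := by
    intro t ht
    rw [← abs_sin_pi_mul_sub_int t (round t)]
    have := two_mul_abs_le_abs_sin (abs_sub_round t)
    linarith [ht (round t)]
  have h1 : h ≤ |Real.sin (Real.pi * t)| := by
    refine key t fun n => ?_
    by_contra! hn
    refine hθ (Or.inl ⟨t - n, ?_, ?_⟩)
    · rw [Scale.interval, hlo, hhi, mem_Icc, ← abs_le]; linarith
    · simp only
      rw [AddCircle.coe_sub, sub_eq_self, AddCircle.coe_eq_zero_iff]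
      exact ⟨n, by simp⟩
  have h2 : h ≤ |Real.sin (Real.pi * (t - α))| := by
    refine key _ fun n => ?_
    by_contra! hn
    refine hθ (Or.inr (mem_translate_arc.2 ⟨t - n - ω, ?_, ?_⟩))
    · rw [Scale.interval, hlo, hhi, mem_Icc, ← abs_le]
      calc |t - n - ω| = |(t - α - n) + (α - ω)| := by ring_nf
        _ ≤ |t - α - n| + |α - ω| := abs_add_le _ _
        _ ≤ h := by linarith
    · have : (t - n - ω + (1 : ℤ) * ω : ℝ) = t - n := by push_cast; ring
      rw [this, AddCircle.coe_sub]
      refine sub_eq_self.2 ((AddCircle.coe_eq_zero_iff _).2 ⟨n, by simp⟩)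
  have h3 : 2 * h ^ 2 ≤ |g α (t : UnitAddCircle)| := by
    rw [g_coe, gLift_eq, abs_mul, abs_mul]
    norm_num
    nlinarith
  have h4 : 4 * h ^ 4 ≤ g α (t : UnitAddCircle) ^ 2 := by
    rw [← sq_abs]; nlinarith [sq_nonneg h]
  have h5 := c_le_of_le (α := α) (θ := (t : UnitAddCircle)) (lam := lam) (u := 2500)
    (by norm_num) hβ (by nlinarith)
  refine h5.trans (by norm_num)

/-- Close to the second peak, but at distance `ε` from it, the forcing constant stays below `4`. -/
theorem c_le_of_far {h : ℝ} (hl : 0 ≤ lam) (hκ : 0 < κ) (hα : |α - ω| ≤ h / 2)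
    (hω : ∀ n : ℤ, κ ≤ |ω - n|) (hhκ : h ≤ κ / 2) (hh : h ≤ 1 / 4)
    (hlam : 320 ≤ 4 * κ ^ 2 * lam) {t ε : ℝ} (ht : |t| ≤ h) (hε : 0 ≤ ε)
    (htε : ε ≤ |t - (α - ω)|) (hβ : β ∈ Icc (0 : ℝ) 1) :
    c lam α β ((t + ω : ℝ) : UnitAddCircle) ≤ 4 - min 1 (400 * ε ^ 2) := by
  have h1 : κ ≤ |Real.sin (Real.pi * (t + ω))| := by
    rw [← abs_sin_pi_mul_sub_int _ (round (t + ω))]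
    have h2 := two_mul_abs_le_abs_sin (abs_sub_round (t + ω))
    have h3 : κ ≤ |t + ω - round (t + ω)| + |t| := by
      calc κ ≤ |ω - round (t + ω)| := hω _
        _ = |(t + ω - round (t + ω)) - t| := by ring_nf
        _ ≤ _ := abs_sub _ _
    linarith
  have h2 : 2 * ε ≤ |Real.sin (Real.pi * (t + ω - α))| := by
    have h3 : t + ω - α = t - (α - ω) := by ring
    rw [h3]
    have h4 : |t - (α - ω)| ≤ 1 / 2 := (abs_sub _ _).trans (by linarith)
    linarith [two_mul_abs_le_abs_sin h4]
  have h3 : 4 * (κ * ε) ≤ |g α ((t + ω : ℝ) : UnitAddCircle)| := by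
    rw [g_coe, gLift_eq, abs_mul, abs_mul]
    norm_num
    nlinarith [mul_le_mul h1 h2 (by positivity) (abs_nonneg _)]
  have h4 : 16 * (κ * ε) ^ 2 ≤ g α ((t + ω : ℝ) : UnitAddCircle) ^ 2 := by
    have := pow_le_pow_left₀ (by positivity) h3 2
    rw [sq_abs] at this
    linarith
  have h5 : 1280 * ε ^ 2 ≤ lam * g α ((t + ω : ℝ) : UnitAddCircle) ^ 2 := by
    calc 1280 * ε ^ 2 ≤ 4 * (4 * κ ^ 2 * lam) * ε ^ 2 := by nlinarith [sq_nonneg ε]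
      _ = lam * (16 * (κ * ε) ^ 2) := by ring
      _ ≤ _ := by gcongr
  -- Truncation at 1 makes the linear bound 1/(1+u) ≤ 1 - u/2 available.
  set u : ℝ := min 1 (1280 * ε ^ 2)
  have hu0 : 0 ≤ u := le_min (by norm_num) (by positivity)
  have hu1 : u ≤ 1 := min_le_left _ _
  have h6 := c_le_of_le hu0 hβ ((min_le_right _ _).trans h5)
  refine h6.trans ?_
  have h7 : 1 / (1 + u) ≤ 1 - u / 2 := by
    rw [div_le_iff₀ (by linarith)]; nlinarith
  have h8 : min 1 (400 * ε ^ 2) ≤ 5 / 4 * u := by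
    rcases min_choice 1 (1280 * ε ^ 2) with h | h
    · have : u = 1 := h
      rw [this]; exact (min_le_left _ _).trans (by norm_num)
    · have : u = 1280 * ε ^ 2 := h
      rw [this]; exact (min_le_right _ _).trans (by nlinarith [sq_nonneg ε])
  linarith

end Estimates

/-- The quantitative facts about the scales `0, …, n` on which the dynamical arguments rest. -/
structure Setting (ω lam α : ℝ) (s : ℕ → Scale) (n : ℕ) : Prop where
  lam_nonneg : 0 ≤ lam
  outside : ∀ β ∈ Icc (0 : ℝ) 1, ∀ θ ∉ (s 0).arc ∪ translate ω (s 0).arc 1,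
    c lam α β θ ≤ 3 / 2 + 1 / 1000
  near : ∀ β ∈ Icc (0 : ℝ) 1, ∀ t ∈ (s 0).interval, ∀ ε : ℝ, 0 ≤ ε → ε ≤ |t - (α - ω)| →
    c lam α β ((t + ω : ℝ) : UnitAddCircle) ≤ 4 - min 1 (400 * ε ^ 2)
  nested : ∀ j k, j ≤ k → k ≤ n → (s k).interval ⊆ (s j).interval
  gap : ∀ k ≤ n, GapBound ω (s k) (7 * ((s k).M : ℤ))
  K_large : ∀ k ≤ n, 200 * 2 ^ k ≤ (s k).K
  K_sq : ∀ k ≤ n, (s k).K ^ 2 ≤ 4 * (s k).M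
  dense : ∀ k ≤ n, ∀ θ, ∃ j : ℕ, angle ω θ j ∈ (s k).arc

/-! ### Orbits away from the peaks -/

/-- The map 3/2 · p fixes 1/3 with multiplier 1/2, which leaves room for the error 1/1000 in the
factor. -/
theorem mapsTo_C {d x : ℝ} (hd : 3 / 2 ≤ d) (hd' : d ≤ 3 / 2 + 1 / 1000) (hx : x ∈ C) :
    d * p x ∈ C := by
  obtain ⟨h1, h2⟩ := hx
  have h3 : (2 : ℝ) / 9 - 0.0035 ≤ p x := by rw [p]; nlinarith
  have h4 : p x ≤ (2 : ℝ) / 9 + 0.0034 := by rw [p]; nlinarith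
  constructor <;> nlinarith

theorem mapsTo_mid {d x : ℝ} (hd : 3 / 2 ≤ d) (hd' : d ≤ 3 / 2 + 1 / 1000) (hx : x ∈ Mid) :
    d * p x ∈ Icc (148 / 10000 : ℝ) (376 / 1000) := by
  have h3 := p_lower_of_mem_mid hx
  have h4 := p_le_quarter (x := x)
  constructor <;> nlinarith

theorem mapsTo_mid_of_le {d x : ℝ} (hd : 3 / 2 ≤ d) (hd' : d ≤ 4) (hx : x ∈ Mid)
    (hx' : x ≤ 2 / 5) : d * p x ∈ Mid := by
  have h3 := p_lower_of_mem_mid hx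
  have h4 : p x ≤ 24 / 100 := by rw [p]; nlinarith
  constructor <;> nlinarith

/-- Twenty iterations close to `3/2 · p` send `[1/100, 99/100]` into `C`. -/
theorem mem_C_of_twenty {d x : ℕ → ℝ} (hx : x 0 ∈ Mid) (hstep : ∀ i, x (i + 1) = d i * p (x i))
    (hd : ∀ i < 20, 3 / 2 ≤ d i) (hd' : ∀ i < 20, d i ≤ 3 / 2 + 1 / 1000) : x 20 ∈ C := by
  have step : ∀ i < 20, ∀ a b : ℝ, 0 ≤ a → b ≤ 1 / 2 → x i ∈ Icc a b →
      x (i + 1) ∈ Icc (3 / 2 * p a) ((3 / 2 + 1 / 1000) * p b) := by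
    intro i hi a b ha hb hab
    rw [hstep]
    have h1 := hd i hi
    have h2 := hd' i hi
    obtain ⟨h3, h4⟩ := hab
    have h5 : p a ≤ p (x i) := by simp only [p]; nlinarith
    have h6 : p (x i) ≤ p b := by simp only [p]; nlinarith
    have h7 : 0 ≤ p a := p_nonneg ⟨ha, by linarith⟩
    exact ⟨by nlinarith, by nlinarith⟩
  have next : ∀ i < 20, ∀ a b a' b' : ℝ, 0 ≤ a → b ≤ 1 / 2 → x i ∈ Icc a b →
      a' ≤ 3 / 2 * p a → (3 / 2 + 1 / 1000) * p b ≤ b' → x (i + 1) ∈ Icc a' b' :=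
    fun i hi a b a' b' ha hb hab h1 h2 =>
      Icc_subset_Icc h1 h2 (step i hi a b ha hb hab)
  -- From here the orbit is below 1/2, where p increases, so only end points need to be followed.
  -- The decimals are outward roundings of their images. After fifteen steps the interval lies in
  -- `C`, which is then invariant.
  have x1 : x 1 ∈ Icc (148 / 10000 : ℝ) (376 / 1000) := by
    rw [hstep 0]; exact mapsTo_mid (hd 0 (by norm_num)) (hd' 0 (by norm_num)) hx
  have x2 := next 1 (by norm_num) _ _ 0.0218 0.3523 (by norm_num) (by norm_num) x1
    (by norm_num [p]) (by norm_num [p])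
  have x3 := next 2 (by norm_num) _ _ 0.0319 0.3426 (by norm_num) (by norm_num) x2
    (by norm_num [p]) (by norm_num [p])
  have x4 := next 3 (by norm_num) _ _ 0.0463 0.34 (by norm_num) (by norm_num) x3
    (by norm_num [p]) (by norm_num [p])
  have x5 := next 4 (by norm_num) _ _ 0.066 0.34 (by norm_num) (by norm_num) x4
    (by norm_num [p]) (by norm_num [p])
  have x6 := next 5 (by norm_num) _ _ 0.092 0.34 (by norm_num) (by norm_num) x5
    (by norm_num [p]) (by norm_num [p])
  have x7 := next 6 (by norm_num) _ _ 0.125 0.34 (by norm_num) (by norm_num) x6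
    (by norm_num [p]) (by norm_num [p])
  have x8 := next 7 (by norm_num) _ _ 0.164 0.34 (by norm_num) (by norm_num) x7
    (by norm_num [p]) (by norm_num [p])
  have x9 := next 8 (by norm_num) _ _ 0.205 0.34 (by norm_num) (by norm_num) x8
    (by norm_num [p]) (by norm_num [p])
  have x10 := next 9 (by norm_num) _ _ 0.244 0.34 (by norm_num) (by norm_num) x9
    (by norm_num [p]) (by norm_num [p])
  have x11 := next 10 (by norm_num) _ _ 0.276 0.34 (by norm_num) (by norm_num) x10
    (by norm_num [p]) (by norm_num [p])
  have x12 := next 11 (by norm_num) _ _ 0.299 0.34 (by norm_num) (by norm_num) x11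
    (by norm_num [p]) (by norm_num [p])
  have x13 := next 12 (by norm_num) _ _ 0.314 0.34 (by norm_num) (by norm_num) x12
    (by norm_num [p]) (by norm_num [p])
  have x14 := next 13 (by norm_num) _ _ 0.323 0.34 (by norm_num) (by norm_num) x13
    (by norm_num [p]) (by norm_num [p])
  have x15 := next 14 (by norm_num) _ _ 0.324 0.34 (by norm_num) (by norm_num) x14
    (by norm_num [p]) (by norm_num [p])
  have stay : ∀ i, 15 + i ≤ 20 → x (15 + i) ∈ C := by
    intro i
    induction i with
    | zero => exact fun _ => ⟨by linarith [x15.1], by linarith [x15.2]⟩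
    | succ i ih =>
      intro hi
      rw [← add_assoc, hstep]
      exact mapsTo_C (hd _ (by omega)) (hd' _ (by omega)) (ih (by omega))
  exact stay 5 le_rfl

/-- Below `1/100` an orbit grows by the factor `5/4`, and it does not jump over `[1/100, 1/25]`. -/
theorem exists_mem_of_growth {d x : ℕ → ℝ} (hstep : ∀ i, x (i + 1) = d i * p (x i))
    (hd : ∀ i, 3 / 2 ≤ d i) (hd' : ∀ i, d i ≤ 4) {J : ℕ} (h0 : x 0 ≤ 1 / 25) (hpos : 0 ≤ x 0)
    (hJ : 1 / 100 ≤ x 0 * (5 / 4) ^ J) : ∃ j ≤ J, x j ∈ Icc (1 / 100 : ℝ) (1 / 25) := by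
  induction J generalizing d x with
  | zero => exact ⟨0, le_rfl, by simpa using hJ, h0⟩
  | succ J ih =>
    rcases le_or_gt (1 / 100) (x 0) with h | h
    · exact ⟨0, Nat.zero_le _, h, h0⟩
    · have h1 := hd 0
      have h2 := hd' 0
      have h3 : 99 / 100 * x 0 ≤ p (x 0) := by rw [p]; nlinarith
      have h4 : p (x 0) ≤ x 0 := by rw [p]; nlinarith
      have h5 : 5 / 4 * x 0 ≤ x 1 := by rw [hstep 0]; nlinarith
      have h6 : x 1 ≤ 1 / 25 := by rw [hstep 0]; nlinarith
      obtain ⟨j, hj, hj'⟩ := ih (d := fun i => d (i + 1)) (x := fun i => x (i + 1))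
        (fun i => hstep (i + 1)) (fun i => hd _) (fun i => hd' _) h6 (by simp; linarith) (by
          rw [pow_succ] at hJ
          have : (0 : ℝ) ≤ (5 / 4) ^ J := by positivity
          simp only [zero_add]
          nlinarith)
      exact ⟨j + 1, by omega, hj'⟩

namespace Setting

variable {ω lam α β : ℝ} {s : ℕ → Scale} {n : ℕ} {θ : UnitAddCircle} {x : ℝ}

theorem mono (S : Setting ω lam α s n) {k : ℕ} (hk : k ≤ n) : Setting ω lam α s k where
  lam_nonneg := S.lam_nonneg
  outside := S.outside
  near := S.near
  nested := fun i j hij hj => S.nested i j hij (hj.trans hk)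
  gap := fun j hj => S.gap j (hj.trans hk)
  K_large := fun j hj => S.K_large j (hj.trans hk)
  K_sq := fun j hj => S.K_sq j (hj.trans hk)
  dense := fun j hj => S.dense j (hj.trans hk)

theorem two_hundred_le_K (S : Setting ω lam α s n) {k : ℕ} (hk : k ≤ n) : 200 ≤ (s k).K := by
  have := S.K_large k hk
  have h2 : 1 ≤ 2 ^ k := Nat.one_le_two_pow
  omega

theorem fifty_mul_K_le_M (S : Setting ω lam α s n) {k : ℕ} (hk : k ≤ n) :
    50 * (s k).K ≤ (s k).M := by
  have h1 := S.two_hundred_le_K hk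
  have h2 := S.K_sq k hk
  nlinarith

/-- Translates of `I_j` and of `I_k ⊆ I_j` by different small multiples of `ω` are disjoint. -/
theorem eq_of_mem (S : Setting ω lam α s n) {j k : ℕ} (hjk : j ≤ k) (hk : k ≤ n) {m m' : ℤ}
    (h : θ ∈ translate ω (s j).arc m) (h' : θ ∈ translate ω (s k).arc m')
    (hm : |m - m'| ≤ 7 * (s j).M) : m = m' :=
  (S.gap j (hjk.trans hk)).eq_of_mem (S.nested j k hjk hk) h h' hm

theorem notMem_zero_of_mem (S : Setting ω lam α s n) {k : ℕ} (hk : k ≤ n) {m : ℤ}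
    (h : θ ∈ translate ω (s k).arc m) (hm : |m| ≤ 20) (h0 : m ≠ 0) (h1 : m ≠ 1) :
    θ ∉ (s 0).arc ∪ translate ω (s 0).arc 1 := by
  have h2 := S.fifty_mul_K_le_M (Nat.zero_le n)
  have h3 := S.two_hundred_le_K (Nat.zero_le n)
  rw [abs_le] at hm
  rintro (h' | h')
  · rw [← translate_zero (ω := ω) (I := (s 0).arc)] at h'
    exact h0 (S.eq_of_mem (Nat.zero_le k) hk h' h (by rw [abs_le]; constructor <;> omega)).symm
  · exact h1 (S.eq_of_mem (Nat.zero_le k) hk h' h (by rw [abs_le]; constructor <;> omega)).symm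

theorem notMem_of_mem_ΘPrev (S : Setting ω lam α s n) (h : θ ∈ ΘPrev ω s n) :
    θ ∉ (s 0).arc ∪ translate ω (s 0).arc 1 := by
  cases n with
  | zero => exact h
  | succ n =>
    have h2 := S.fifty_mul_K_le_M (Nat.zero_le _)
    have h3 := S.two_hundred_le_K (Nat.zero_le _)
    rintro (h' | h')
    · refine h (mem_iUnion₂.2 ⟨0, Nat.zero_le n, mem_iUnion₂.2 ⟨0, ⟨by omega, by omega⟩, ?_⟩⟩)
      rwa [translate_zero]
    · exact h (mem_iUnion₂.2 ⟨0, Nat.zero_le n, mem_iUnion₂.2 ⟨1, ⟨by omega, by omega⟩, h'⟩⟩)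

theorem notMem_GPrev_of_mem_ΘPrev (S : Setting ω lam α s n) (h : θ ∈ ΘPrev ω s n) :
    θ ∉ GPrev ω s n := by
  intro h'
  obtain ⟨i, hi, h'⟩ := mem_iUnion₂.1 h'
  obtain ⟨m, hm, hmem⟩ := mem_iUnion₂.1 h'
  clear h'
  cases n with
  | zero => exact absurd hi (Nat.not_lt_zero i)
  | succ n =>
    have hi' : i ≤ n := Nat.lt_succ_iff.1 hi
    have h2 := S.fifty_mul_K_le_M (hi'.trans n.le_succ)
    have hm1 := hm.1
    have hm2 := hm.2
    exact h (mem_iUnion₂.2 ⟨i, hi', mem_iUnion₂.2 ⟨m, ⟨by omega, by omega⟩, hmem⟩⟩)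

theorem fibre_mem_mid_of_outside (S : Setting ω lam α s n) (hβ : β ∈ Icc (0 : ℝ) 1)
    (hθ : θ ∉ (s 0).arc ∪ translate ω (s 0).arc 1) (hx : x ∈ Mid) :
    c lam α β θ * p x ∈ Icc (148 / 10000 : ℝ) (376 / 1000) :=
  mapsTo_mid (c_lower S.lam_nonneg hβ) (S.outside β hβ θ hθ) hx

theorem fibre_twenty_mem_C (S : Setting ω lam α s n) (hβ : β ∈ Icc (0 : ℝ) 1) (hx : x ∈ Mid)
    (hθ : ∀ i < 20, angle ω θ i ∉ (s 0).arc ∪ translate ω (s 0).arc 1) :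
    fibre ω lam α β θ x 20 ∈ C :=
  mem_C_of_twenty (d := fun i => c lam α β (angle ω θ i)) (x := fibre ω lam α β θ x) hx
    (fun i => fibre_succ i) (fun _ _ => c_lower S.lam_nonneg hβ)
    (fun i hi => S.outside β hβ _ (hθ i hi))

/-- Growth may end over `I₀` or `I₀ + ω`, where (ii) cannot be started. At most two further steps
leave these arcs. Each multiplies x by at most 4 and keeps it above 1/100, so starting below 1/25
the orbit remains in `Mid`. -/
theorem exists_outside_mem_mid (S : Setting ω lam α s n) (hβ : β ∈ Icc (0 : ℝ) 1)
    (hx : x ∈ Icc (1 / 100 : ℝ) (1 / 25)) : ∃ j ≤ 2,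
      angle ω θ j ∉ (s 0).arc ∪ translate ω (s 0).arc 1 ∧ fibre ω lam α β θ x j ∈ Mid := by
  have bounds : ∀ θ : UnitAddCircle, ∀ y ∈ Icc (1 / 100 : ℝ) (1 / 4),
      c lam α β θ * p y ∈ Icc (1 / 100) (min (4 * y) (99 / 100)) := by
    intro θ y hy
    have h1 := c_lower (α := α) (θ := θ) S.lam_nonneg hβ
    have h2 := c_le_four (α := α) (θ := θ) S.lam_nonneg hβ
    obtain ⟨h3, h4⟩ := hy
    have h5 : 99 / 10000 ≤ p y := p_lower_of_mem_mid ⟨h3, by linarith⟩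
    have h6 : p y ≤ y := by rw [p]; nlinarith
    have h7 : p y ≤ 3 / 16 := by rw [p]; nlinarith
    exact ⟨by nlinarith, le_min (by nlinarith) (by nlinarith)⟩
  have hx0 : x ∈ Icc (1 / 100 : ℝ) (1 / 4) := ⟨hx.1, by linarith [hx.2]⟩
  have h1 := bounds θ x hx0
  have h1' : c lam α β θ * p x ∈ Icc (1 / 100 : ℝ) (1 / 4) :=
    ⟨h1.1, (h1.2.trans (min_le_left _ _)).trans (by linarith [hx.2])⟩
  have h2 := bounds (angle ω θ 1) _ h1'
  by_cases hθ0 : θ ∈ (s 0).arc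
  · refine ⟨2, le_rfl, ?_, ?_⟩
    · rw [← translate_zero (ω := ω) (I := (s 0).arc)] at hθ0
      have := angle_mem_translate_of_mem (k := 2) hθ0
      exact S.notMem_zero_of_mem (Nat.zero_le n) this (by norm_num) (by norm_num) (by norm_num)
    · rw [fibre_succ, fibre_one]
      exact ⟨h2.1, h2.2.trans (min_le_right _ _)⟩
  by_cases hθ1 : θ ∈ translate ω (s 0).arc 1
  · refine ⟨1, by norm_num, ?_, ?_⟩
    · have := angle_mem_translate_of_mem (k := 1) hθ1
      exact S.notMem_zero_of_mem (Nat.zero_le n) this (by norm_num) (by norm_num) (by norm_num)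
    · rw [fibre_one]
      exact ⟨h1.1, h1.2.trans (min_le_right _ _)⟩
  · exact ⟨0, by norm_num, by simpa using ⟨hθ0, hθ1⟩, hx.1, by simp; linarith [hx.2]⟩

end Setting

/-! ### Recovery after a passage through the peaks -/

namespace Setting

variable {ω lam α β : ℝ} {s : ℕ → Scale} {n : ℕ} {θ : UnitAddCircle} {x : ℝ}

theorem angle_notMem_arc (S : Setting ω lam α s n) {k : ℕ} (hk : k ≤ n) {m : ℤ}
    (h : θ ∈ translate ω (s k).arc m) {i : ℕ} (h0 : m + i ≠ 0)
    (h1 : |m + i| ≤ 7 * ((s k).M : ℤ)) : angle ω θ i ∉ (s k).arc := by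
  intro h'
  rw [← translate_zero (ω := ω) (I := (s k).arc)] at h'
  exact h0 (S.eq_of_mem le_rfl hk (angle_mem_translate_of_mem h) h' (by simpa using h1))

/-- The core of the recovery, started just after both peaks. The hypothesis on `p x` measures the
distance of x to 0 and to 1 at once, and says that 2K_n - 6 steps of growth by 5/4 suffice. Once the
orbit is in `Mid`, (ii) applies up to time T, since I_n is not met before then, and θ_T ∈ Θ_{n-1}
excludes the exceptional set. The three lemmas on earlier starting arcs each prepend one step, which
raises the lower bound on T by one. -/
theorem fibre_mem_C_of_mem_two (S : Setting ω lam α s n) (hII : PropII ω lam α s n)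
    (hβ : β ∈ Icc (0 : ℝ) 1) (hθ : θ ∈ translate ω (s n).arc 2) (hx : x ∈ Icc (0 : ℝ) 1)
    (hpx : 1 / 150 ≤ p x * (5 / 4) ^ (2 * (s n).K - 6)) {T : ℕ} (hT : 2 * (s n).K ≤ T + 3)
    (hT' : T ≤ 3 * (s n).K) (hΘ : ∀ i ≤ 20, angle ω θ (T + i) ∈ ΘPrev ω s n) :
    fibre ω lam α β θ x (T + 20) ∈ C := by
  have hM := S.fifty_mul_K_le_M (le_refl n)
  have hK := S.two_hundred_le_K (le_refl n)
  have hnot : ∀ i ≤ T, angle ω θ i ∉ (s n).arc := fun i hi =>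
    S.angle_notMem_arc le_rfl hθ (by omega) (by rw [abs_le]; constructor <;> omega)
  have hθ0 := S.notMem_zero_of_mem le_rfl hθ (by norm_num) (by norm_num) (by norm_num)
  have start : ∃ j ≤ T, angle ω θ j ∉ (s 0).arc ∪ translate ω (s 0).arc 1 ∧
      fibre ω lam α β θ x j ∈ Mid := by
    by_cases hmid : x ∈ Mid
    · exact ⟨0, Nat.zero_le _, by simpa using hθ0, by simpa using hmid⟩
    have hp : p x ≤ 99 / 10000 := by
      rw [Mid, mem_Icc, not_and_or, not_le, not_le] at hmid
      rw [p]
      rcases hmid with h | h <;> nlinarith [hx.1, hx.2]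
    have h1 := c_lower (α := α) (θ := θ) S.lam_nonneg hβ
    have h2 := S.outside β hβ θ hθ0
    have h3 := p_nonneg hx
    have h4 : fibre ω lam α β θ x 1 ≤ 1 / 25 := by rw [fibre_one]; nlinarith
    have h5 : 3 / 2 * p x ≤ fibre ω lam α β θ x 1 := by rw [fibre_one]; nlinarith
    obtain ⟨j, hj, hj'⟩ := exists_mem_of_growth
      (d := fun i => c lam α β (angle ω θ (i + 1)))
      (x := fun i => fibre ω lam α β θ x (i + 1)) (J := 2 * (s n).K - 6)
      (fun i => fibre_succ (i + 1)) (fun _ => c_lower S.lam_nonneg hβ)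
      (fun _ => c_le_four S.lam_nonneg hβ) h4 (by simp only [zero_add]; linarith) (by
        have : (0 : ℝ) < (5 / 4) ^ (2 * (s n).K - 6) := by positivity
        simp only [zero_add]
        nlinarith)
    obtain ⟨i, hi, h6, h7⟩ := S.exists_outside_mem_mid (θ := angle ω θ (j + 1)) hβ hj'
    rw [← angle_add] at h6
    rw [← fibre_add] at h7
    -- The time used is at most 1 + (2K_n - 6) + 2 = 2K_n - 3, the lower bound assumed for T.
    exact ⟨j + 1 + i, by omega, h6, h7⟩
  obtain ⟨j, hj, h1, h2⟩ := start
  have hmid : fibre ω lam α β θ x T ∈ Mid := by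
    by_contra hcon
    have hle : T - j ≤ hit ω (angle ω θ j) (s n).arc :=
      le_hit (S.dense n le_rfl _) fun i hi => by
        rw [← angle_add]; exact hnot _ (by omega)
    have h3 := hII β hβ _ h2 _ h1 _ hle
    rw [← angle_add, ← fibre_add, Nat.add_sub_cancel' hj] at h3
    exact S.notMem_GPrev_of_mem_ΘPrev (hΘ 0 (by norm_num)) (h3 hcon)
  rw [fibre_add]
  refine S.fibre_twenty_mem_C hβ hmid fun i hi => ?_
  rw [← angle_add]
  exact S.notMem_of_mem_ΘPrev (hΘ i hi.le)

/-- Two dangers are controlled separately: `v` keeps the image away from 1, and `w` keeps x itself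
away from 1, so that the image is not too close to 0. The bound `w` is 99/100 if x lies in `Mid`,
and `V β` if x is the image of an arbitrary point of `Mid` over I_n. -/
theorem fibre_mem_C_of_mem_one (S : Setting ω lam α s n) (hII : PropII ω lam α s n)
    (hβ : β ∈ Icc (0 : ℝ) 1) (hθ : θ ∈ translate ω (s n).arc 1) {v w : ℝ}
    (hx : x ∈ Icc (1 / 100) w) (hw1 : w ≤ 1) (hc : c lam α β θ ≤ 4 * v)
    (hw : 1 / 150 ≤ p w * (5 / 4) ^ (2 * (s n).K - 6))
    (hv : 1 / 150 ≤ p v * (5 / 4) ^ (2 * (s n).K - 6)) {T : ℕ} (hT : 2 * (s n).K ≤ T + 2)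
    (hT' : T ≤ 3 * (s n).K) (hΘ : ∀ i ≤ 20, angle ω θ (T + i) ∈ ΘPrev ω s n) :
    fibre ω lam α β θ x (T + 20) ∈ C := by
  have hK := S.two_hundred_le_K (le_refl n)
  obtain ⟨T, rfl⟩ : ∃ T', T = 1 + T' := ⟨T - 1, by omega⟩
  have hx1 : x ∈ Icc (0 : ℝ) 1 := ⟨by linarith [hx.1], hx.2.trans hw1⟩
  have hJ : (1 : ℝ) ≤ (5 / 4) ^ (2 * (s n).K - 6) := one_le_pow₀ (by norm_num)
  have hsmall : 1 / 150 ≤ p (1 / 100) * (5 / 4) ^ (2 * (s n).K - 6) := by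
    norm_num [p] at hJ ⊢; linarith
  have hmin : ∀ u y : ℝ, 1 / 150 ≤ p u * (5 / 4) ^ (2 * (s n).K - 6) →
      y ∈ Icc (1 / 100) u → 1 / 150 ≤ p y * (5 / 4) ^ (2 * (s n).K - 6) := by
    intro u y hu hy
    have h := min_p_le hy
    rcases min_choice (p (1 / 100)) (p u) with h' | h' <;> rw [h'] at h <;> nlinarith
  have h1 := c_lower (α := α) (θ := θ) S.lam_nonneg hβ
  have hp0 := p_nonneg hx1
  have hy := c_mul_p_mem (α := α) (θ := θ) S.lam_nonneg hβ hx1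
  have hyp : 1 / 150 ≤ p (c lam α β θ * p x) * (5 / 4) ^ (2 * (s n).K - 6) := by
    rcases le_or_gt (1 / 100) (c lam α β θ * p x) with h | h
    · exact hmin v _ hv ⟨h, by nlinarith [p_le_quarter (x := x)]⟩
    · have h2 : p x ≤ p (c lam α β θ * p x) := by
        rw [p.eq_def (c lam α β θ * p x)]; nlinarith [hy.1]
      have := hmin w x hw hx
      nlinarith
  rw [add_assoc, fibre_add, fibre_one]
  refine S.fibre_mem_C_of_mem_two hII hβ ?_ hy hyp (by omega) (by omega) fun i hi => ?_
  · exact angle_mem_translate_of_mem (k := 1) hθ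
  · rw [← angle_add, ← add_assoc]; exact hΘ i hi

theorem p_mid_mul_pow (k : ℕ) : 1 / 150 ≤ p (99 / 100) * (5 / 4) ^ k := by
  have hJ : (1 : ℝ) ≤ (5 / 4) ^ k := one_le_pow₀ (by norm_num)
  norm_num [p] at hJ ⊢; linarith

theorem fibre_mem_C_of_mem_zero (S : Setting ω lam α s n) (hII : PropII ω lam α s n)
    (hβ : β ∈ Icc (0 : ℝ) 1) (hθ : θ ∈ (s n).arc) {v : ℝ}
    (hx : x ∈ Mid) (hx' : x ≤ 2 / 5) (hc : c lam α β (angle ω θ 1) ≤ 4 * v)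
    (hv : 1 / 150 ≤ p v * (5 / 4) ^ (2 * (s n).K - 6)) {T : ℕ} (hT : 2 * (s n).K ≤ T + 1)
    (hT' : T ≤ 3 * (s n).K) (hΘ : ∀ i ≤ 20, angle ω θ (T + i) ∈ ΘPrev ω s n) :
    fibre ω lam α β θ x (T + 20) ∈ C := by
  have hK := S.two_hundred_le_K (le_refl n)
  obtain ⟨T, rfl⟩ : ∃ T', T = 1 + T' := ⟨T - 1, by omega⟩
  rw [← translate_zero (ω := ω) (I := (s n).arc)] at hθ
  have h1 : c lam α β θ * p x ∈ Mid :=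
    mapsTo_mid_of_le (c_lower S.lam_nonneg hβ) (c_le_four S.lam_nonneg hβ) hx hx'
  rw [add_assoc, fibre_add, fibre_one]
  refine S.fibre_mem_C_of_mem_one hII hβ ?_ h1 (by norm_num) hc (p_mid_mul_pow _) hv
    (by omega) (by omega) fun i hi => ?_
  · exact angle_mem_translate_of_mem (k := 1) hθ
  · rw [← angle_add, ← add_assoc]; exact hΘ i hi

theorem fibre_mem_C_of_mem_neg_one (S : Setting ω lam α s n) (hII : PropII ω lam α s n)
    (hβ : β ∈ Icc (0 : ℝ) 1) (hθ : θ ∈ translate ω (s n).arc (-1)) {v : ℝ}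
    (hx : x ∈ Mid) (hc : c lam α β (angle ω θ 2) ≤ 4 * v)
    (hv : 1 / 150 ≤ p v * (5 / 4) ^ (2 * (s n).K - 6)) {T : ℕ} (hT : 2 * (s n).K ≤ T)
    (hT' : T ≤ 3 * (s n).K) (hΘ : ∀ i ≤ 20, angle ω θ (T + i) ∈ ΘPrev ω s n) :
    fibre ω lam α β θ x (T + 20) ∈ C := by
  have hK := S.two_hundred_le_K (le_refl n)
  obtain ⟨T, rfl⟩ : ∃ T', T = 1 + T' := ⟨T - 1, by omega⟩
  have h1 := S.fibre_mem_mid_of_outside hβ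
    (S.notMem_zero_of_mem le_rfl hθ (by norm_num) (by norm_num) (by norm_num)) hx
  rw [add_assoc, fibre_add, fibre_one]
  refine S.fibre_mem_C_of_mem_zero (v := v) hII hβ ?_ ⟨by linarith [h1.1], by linarith [h1.2]⟩
    (by linarith [h1.2]) ?_ hv (by omega) (by omega) fun i hi => ?_
  · have := angle_mem_translate_of_mem (k := 1) hθ
    simpa using this
  · rwa [← angle_add]
  · rw [← angle_add, ← add_assoc]; exact hΘ i hi

/-- The upper bound for `c / 4` over `I_n + ω` at distance `(4/5)^K / 2` from the peak. -/
noncomputable def farBound (K : ℕ) : ℝ := 1 - min (1 / 4) (100 * ((4 / 5 : ℝ) ^ K / 2) ^ 2)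

/-- The deficit 1 - `farBound K` is of order (4/5)^{2K}, which 2K - 6 factors 5/4 compensate up to a
constant. -/
theorem p_farBound {K : ℕ} (hK : 200 ≤ K) : 1 / 150 ≤ p (farBound K) * (5 / 4) ^ (2 * K - 6) := by
  have h1 : (4 / 5 : ℝ) ^ K * (4 / 5) ^ K * (5 / 4) ^ (2 * K - 6) = (4 / 5) ^ 6 := by
    obtain ⟨m, hm⟩ : ∃ m, 2 * K - 6 = m := ⟨_, rfl⟩
    rw [hm, ← pow_add, show K + K = 6 + m by omega, pow_add, mul_assoc, ← mul_pow]
    norm_num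
  have h2 : (1 : ℝ) ≤ (5 / 4) ^ (2 * K - 6) := one_le_pow₀ (by norm_num)
  set ε : ℝ := 100 * ((4 / 5 : ℝ) ^ K / 2) ^ 2 with hε
  have h3 : 3 / 4 * min (1 / 4) ε ≤ p (farBound K) := by
    rw [p, farBound, ← hε]
    have h4 : 0 ≤ min (1 / 4) ε := le_min (by norm_num) (by positivity)
    have h5 : min (1 / 4) ε ≤ 1 / 4 := min_le_left _ _
    nlinarith
  rcases min_choice (1 / 4) ε with h | h <;> rw [h] at h3
  · nlinarith
  · have h4 : ε * (5 / 4) ^ (2 * K - 6) = 25 * (4 / 5) ^ 6 := by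
      rw [← h1, hε]; ring
    have h5 : 3 / 4 * ε * (5 / 4) ^ (2 * K - 6) ≤ p (farBound K) * (5 / 4) ^ (2 * K - 6) := by
      gcongr
    have h6 : (1 : ℝ) / 150 ≤ 3 / 4 * (25 * (4 / 5) ^ 6) := by norm_num
    linarith

theorem c_le_farBound (S : Setting ω lam α s n) (hβ : β ∈ Icc (0 : ℝ) 1)
    {I : Scale} {K : ℕ} (hlo : I.lo = α - ω - (4 / 5 : ℝ) ^ K / 2)
    (hhi : I.hi = α - ω + (4 / 5 : ℝ) ^ K / 2)
    (hθ : θ ∈ translate ω (s n).arc 1) (hθ' : θ ∉ translate ω I.arc 1) :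
    c lam α β θ ≤ 4 * farBound K := by
  obtain ⟨t, ht, rfl⟩ := mem_translate_arc.1 hθ
  have ht' : t ∉ I.interval := fun h => hθ' (mem_translate_arc.2 ⟨t, h, rfl⟩)
  have hε : (4 / 5 : ℝ) ^ K / 2 ≤ |t - (α - ω)| := by
    by_contra! h
    rw [abs_lt] at h
    exact ht' ⟨by rw [hlo]; linarith [h.1], by rw [hhi]; linarith [h.2]⟩
  have h := S.near β hβ t (S.nested 0 n (Nat.zero_le n) le_rfl ht) _ (by positivity) hε
  have h1 : (t + (1 : ℤ) * ω : ℝ) = t + ω := by push_cast; ring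
  rw [h1]
  refine h.trans (le_of_eq ?_)
  rw [farBound, mul_sub, mul_min_of_nonneg _ _ (by norm_num : (0 : ℝ) ≤ 4)]
  norm_num
  ring_nf

end Setting

/-! ### Properties (iii) and (ii) at the next scale -/

section Step

variable {ω lam α β : ℝ} {s : ℕ → Scale} {n : ℕ} {θ : UnitAddCircle} {x : ℝ}

theorem GPrev_mono {m : ℕ} (h : n ≤ m) : GPrev ω s n ⊆ GPrev ω s m :=
  biUnion_subset_biUnion_left (Iio_subset_Iio h)

theorem ΘPrev_antitone (S : Setting ω lam α s n) : ΘPrev ω s (n + 1) ⊆ ΘPrev ω s n := by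
  cases n with
  | zero =>
    intro θ h h'
    have h3 := S.two_hundred_le_K (Nat.zero_le _)
    have h2 := S.fifty_mul_K_le_M (Nat.zero_le _)
    rcases h' with h' | h'
    · refine h (mem_iUnion₂.2 ⟨0, Nat.zero_le _, mem_iUnion₂.2 ⟨0, ⟨by omega, by omega⟩, ?_⟩⟩)
      rwa [translate_zero]
    · exact h (mem_iUnion₂.2 ⟨0, Nat.zero_le _, mem_iUnion₂.2 ⟨1, ⟨by omega, by omega⟩, h'⟩⟩)
  | succ n =>
    exact compl_subset_compl.2 (biUnion_subset_biUnion_left (Iic_subset_Iic.2 n.le_succ))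

theorem mem_GPrev_succ {m : ℤ} (h : θ ∈ translate ω (s n).arc m) (h0 : 0 ≤ m)
    (h1 : m ≤ 3 * (s n).K) : θ ∈ GPrev ω s (n + 1) :=
  mem_iUnion₂.2 ⟨n, n.lt_succ_self, mem_iUnion₂.2 ⟨m, ⟨h0, h1⟩, h⟩⟩

theorem C_le {x : ℝ} (hx : x ∈ C) : x ≤ 2 / 5 := hx.2.trans (by norm_num)

/-- A passage over `I_n \ I_{n+1}` ends in `C` after `2 K_n + 20` steps. -/
theorem Setting.fibre_mem_C_of_passage (S : Setting ω lam α s n) (hII : PropII ω lam α s n)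
    (hret : Return ω s n) (hstd : IsStandardSucc ω α s n) (hβ : β ∈ Icc (0 : ℝ) 1)
    (hθ : θ ∈ (s n).arc) (hθ' : θ ∉ (s (n + 1)).arc) (hx : x ∈ Mid) (hx' : x ≤ 2 / 5) :
    fibre ω lam α β θ x (2 * (s n).K + 20) ∈ C := by
  have hK := S.two_hundred_le_K (le_refl n)
  have hθ0 := hθ
  rw [← translate_zero (ω := ω) (I := (s n).arc)] at hθ0
  refine S.fibre_mem_C_of_mem_zero hII hβ hθ hx hx' ?_ (Setting.p_farBound hK) (by omega)
    (by omega) fun i hi => ?_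
  · refine S.c_le_farBound hβ hstd.lo_eq hstd.hi_eq ?_ ?_
    · exact angle_mem_translate_of_mem (k := 1) hθ0
    · rw [angle_mem_translate]; simpa using hθ'
  · refine hret.1 i ⟨by omega, by omega⟩ ?_
    have := angle_mem_translate_of_mem (k := 2 * (s n).K + i) hθ0
    push_cast at this
    rwa [zero_add] at this

theorem Setting.angle_passage (hret : Return ω s n) (hθ : θ ∈ (s n).arc) :
    angle ω θ (2 * (s n).K + 20) ∈ ΘPrev ω s n := by
  rw [← translate_zero (ω := ω) (I := (s n).arc)] at hθ
  refine hret.1 20 ⟨by omega, by omega⟩ ?_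
  have := angle_mem_translate_of_mem (k := 2 * (s n).K + 20) hθ
  push_cast at this
  rwa [zero_add] at this

theorem Setting.angle_notMem_arc_of_mem (S : Setting ω lam α s n) (hθ : θ ∈ (s n).arc) {i : ℕ}
    (h0 : i ≠ 0) (h1 : i ≤ 7 * (s n).M) : angle ω θ i ∉ (s n).arc := by
  rw [← translate_zero (ω := ω) (I := (s n).arc)] at hθ
  exact S.angle_notMem_arc le_rfl hθ (by omega) (by rw [abs_le]; constructor <;> omega)

/-- If the orbit starts in I_n, a passage returns it to C. Otherwise (iii) at scale n does so at the
first visit to I_n. Either way a strictly shorter orbit with the same end remains. A passage cannot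
overshoot the end, because the return time to I_n exceeds 7M_n. -/
theorem propIII_succ (S : Setting ω lam α s (n + 1)) (h : PropsIToIII ω lam α s n)
    (hstd : IsStandardSucc ω α s n) : PropIII ω lam α s (n + 1) := by
  have S' := S.mono n.le_succ
  have hM := S'.fifty_mul_K_le_M (le_refl n)
  have hK := S'.two_hundred_le_K (le_refl n)
  have hsub : (s (n + 1)).arc ⊆ (s n).arc := arc_mono (S.nested n (n + 1) n.le_succ le_rfl)
  intro β hβ
  have key : ∀ N : ℕ, ∀ x ∈ C, ∀ θ, angle ω θ N ∈ (s (n + 1)).arc →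
      (∀ j < N, angle ω θ j ∉ (s (n + 1)).arc) → fibre ω lam α β θ x N ∈ C := by
    intro N
    induction N using Nat.strong_induction_on with
    | _ N ih =>
      intro x hx θ hN hj
      have restart : ∀ t, 0 < t → t ≤ N → fibre ω lam α β θ x t ∈ C →
          fibre ω lam α β θ x N ∈ C := by
        intro t ht htN hC
        rw [← Nat.add_sub_cancel' htN, fibre_add]
        refine ih (N - t) (by omega) _ hC _ ?_ fun j hj' => ?_
        · rwa [← angle_add, Nat.add_sub_cancel' htN]
        · rw [← angle_add]; exact hj _ (by omega)
      rcases Nat.eq_zero_or_pos N with rfl | hN0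
      · simpa using hx
      by_cases hθ : θ ∈ (s n).arc
      · have hθ' : θ ∉ (s (n + 1)).arc := by simpa using hj 0 hN0
        refine restart (2 * (s n).K + 20) (by omega) ?_
          (S'.fibre_mem_C_of_passage h.ii h.i.2 hstd hβ hθ hθ' (C_subset_mid hx) (C_le hx))
        by_contra! hlt
        exact S'.angle_notMem_arc_of_mem hθ hN0.ne' (by omega) (hsub hN)
      · have h1 := h.iii β hβ x hx θ hθ
        refine restart _ (Nat.pos_of_ne_zero fun h0 => ?_) (hit_le (hsub hN)) h1
        have h2 := angle_hit_mem (S'.dense n le_rfl θ)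
        rw [h0, angle_zero] at h2
        exact hθ h2
  intro x hx θ _
  exact key _ x hx θ (angle_hit_mem (S.dense _ le_rfl θ)) fun j hj => angle_notMem_of_lt_hit hj

/-- Over a first visit to `I_n` the fibre coordinate is in the part of `[1/100, 99/100]` left
of `2/5`. -/
theorem Setting.fibre_hit_mem (S : Setting ω lam α s n) (hII : PropII ω lam α s n)
    (hβ : β ∈ Icc (0 : ℝ) 1) (hx : x ∈ Mid) (hθ : θ ∉ (s 0).arc ∪ translate ω (s 0).arc 1) :
    fibre ω lam α β θ x (hit ω θ (s n).arc) ∈ Icc (148 / 10000 : ℝ) (376 / 1000) := by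
  have h1 := angle_hit_mem (S.dense n le_rfl θ)
  obtain ⟨j, hj⟩ : ∃ j, hit ω θ (s n).arc = j + 1 := by
    refine Nat.exists_eq_succ_of_ne_zero fun h0 => hθ (Or.inl ?_)
    rw [h0, angle_zero] at h1
    exact arc_mono (S.nested 0 n (Nat.zero_le n) le_rfl) h1
  rw [hj] at h1 ⊢
  rw [← translate_zero (ω := ω) (I := (s n).arc)] at h1
  have h2 : angle ω θ j ∈ translate ω (s n).arc (-1) := by
    rw [angle_mem_translate] at h1 ⊢
    rwa [show (-1 : ℤ) - j = 0 - ((j + 1 : ℕ) : ℤ) by push_cast; ring]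
  rw [fibre_succ]
  refine S.fibre_mem_mid_of_outside hβ
    (S.notMem_zero_of_mem le_rfl h2 (by norm_num) (by norm_num) (by norm_num)) ?_
  -- One step before the visit the angle is in I_n - ω. Membership in some I_i + mω with 0 ≤ m ≤
  -- 3K_i would force m = -1 by the gap bound.
  by_contra hcon
  have h3 := hII β hβ x hx θ hθ j (by omega) hcon
  obtain ⟨i, hi, h4⟩ := mem_iUnion₂.1 h3
  obtain ⟨m, hm, h5⟩ := mem_iUnion₂.1 h4
  have hi' : i < n := hi
  have hm1 := hm.1
  have hm2 := hm.2
  have hM := S.fifty_mul_K_le_M hi'.le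
  have hK := S.two_hundred_le_K hi'.le
  have h6 := S.eq_of_mem hi'.le le_rfl h5 h2 (by rw [abs_le]; constructor <;> omega)
  omega

theorem propII_succ (S : Setting ω lam α s (n + 1)) (h : PropsIToIII ω lam α s n)
    (hstd : IsStandardSucc ω α s n) : PropII ω lam α s (n + 1) := by
  have S' := S.mono n.le_succ
  have hM := S'.fifty_mul_K_le_M (le_refl n)
  have hK := S'.two_hundred_le_K (le_refl n)
  have hsub : (s (n + 1)).arc ⊆ (s n).arc := arc_mono (S.nested n (n + 1) n.le_succ le_rfl)
  intro β hβ
  have key : ∀ N : ℕ, ∀ x ∈ Mid, ∀ θ ∉ (s 0).arc ∪ translate ω (s 0).arc 1,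
      angle ω θ N ∈ (s (n + 1)).arc → (∀ j < N, angle ω θ j ∉ (s (n + 1)).arc) →
      ∀ k ≤ N, fibre ω lam α β θ x k ∉ Mid → angle ω θ k ∈ GPrev ω s (n + 1) := by
    intro N
    induction N using Nat.strong_induction_on with
    | _ N ih =>
      intro x hx θ hθ hN hj k hk hxk
      have hh := hit_le (hsub hN)
      have h1 := angle_hit_mem (S'.dense n le_rfl θ)
      have h2 := S'.fibre_hit_mem h.ii hβ hx hθ
      rcases le_or_gt k (hit ω θ (s n).arc) with hkh | hkh
      · exact GPrev_mono n.le_succ (h.ii β hβ x hx θ hθ k hkh hxk)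
      have h3 := S'.fibre_mem_C_of_passage (x := fibre ω lam α β θ x (hit ω θ (s n).arc)) h.ii
        h.i.2 hstd hβ h1 (hj _ (by omega))
        ⟨by linarith [h2.1], by linarith [h2.2]⟩ (by linarith [h2.2])
      have h4 := Setting.angle_passage h.i.2 h1
      set t := hit ω θ (s n).arc
      rw [← fibre_add] at h3
      rw [← angle_add] at h4
      rcases le_or_gt k (t + (2 * (s n).K + 20)) with hkt | hkt
      · obtain ⟨i, rfl⟩ : ∃ i, k = t + i := ⟨k - t, by omega⟩
        rw [← translate_zero (ω := ω) (I := (s n).arc)] at h1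
        have h5 := angle_mem_translate_of_mem (k := i) h1
        rw [angle_add]
        exact mem_GPrev_succ h5 (by omega) (by omega)
      · obtain ⟨i, rfl⟩ : ∃ i, k = t + (2 * (s n).K + 20) + i :=
          ⟨k - (t + (2 * (s n).K + 20)), by omega⟩
        rw [angle_add]
        rw [fibre_add] at hxk
        refine ih (N - (t + (2 * (s n).K + 20))) (by omega) _ (C_subset_mid h3) _
          (S'.notMem_of_mem_ΘPrev h4) ?_ (fun j hj' => ?_) i (by omega) hxk
        · rwa [← angle_add, Nat.add_sub_cancel' (by omega)]
        · rw [← angle_add]; exact hj _ (by omega)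
  intro x hx θ hθ
  exact key _ x hx θ hθ (angle_hit_mem (S.dense _ le_rfl θ)) fun j hj => angle_notMem_of_lt_hit hj

end Step

/-! ### Products over alternating segments -/

section Chain

variable {b : ℕ → ℝ} {ρ D : ℝ} {M L : ℕ}

/-- All products of `b` over final and initial parts of `[l, r)` are below the power of `ρ`. -/
def GoodSegment (b : ℕ → ℝ) (ρ : ℝ) (l r : ℕ) : Prop :=
  (∀ k, l ≤ k → k < r → ∏ i ∈ Finset.Ico k r, b i < ρ ^ (r - k)) ∧
  (∀ k, l < k → k ≤ r → ∏ i ∈ Finset.Ico l k, b i < ρ ^ (k - l))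

/-- `[l, N)` is an alternating union of good segments of length at least `M` and of segments of
length `L`, starting and ending with a good one. -/
inductive Chain (b : ℕ → ℝ) (ρ : ℝ) (M L : ℕ) : ℕ → ℕ → Prop
  | last {l N : ℕ} : l + M ≤ N → GoodSegment b ρ l N → Chain b ρ M L l N
  | cons {l r N : ℕ} : l + M ≤ r → GoodSegment b ρ l r → Chain b ρ M L (r + L) N →
      Chain b ρ M L l N

theorem prod_Ico_le_pow (hb : ∀ i, 0 ≤ b i) (hD : ∀ i, b i ≤ D) (k l : ℕ) :
    ∏ i ∈ Finset.Ico k l, b i ≤ D ^ (l - k) := by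
  calc ∏ i ∈ Finset.Ico k l, b i ≤ ∏ _i ∈ Finset.Ico k l, D :=
        Finset.prod_le_prod (fun i _ => hb i) fun i _ => hD i
    _ = D ^ (l - k) := by rw [Finset.prod_const, Nat.card_Ico]

theorem GoodSegment.prod_mul_pow_lt {l r : ℕ} (h : GoodSegment b ρ l r) (hM : 0 < M)
    (hlr : l + M ≤ r) (hρ0 : 0 < ρ) (hρ : ρ ≤ 1) (hD1 : 1 ≤ D) (hρD : ρ ^ M * D ^ L ≤ 1) :
    (∏ i ∈ Finset.Ico l r, b i) * D ^ L < 1 := by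
  have h1 := h.1 l le_rfl (by omega)
  have h2 : ρ ^ (r - l) ≤ ρ ^ M := pow_le_pow_of_le_one hρ0.le hρ (by omega)
  have h3 : 0 < D ^ L := by positivity
  nlinarith

/-- The induction carries the stronger bound with the factor D^L: the surplus of a good segment
absorbs the bad segment before it. Initial products use the surplus of the good segment before the
bad one, so they need no such strengthening. -/
theorem Chain.prod_final_lt (h0 : ∀ i, 0 ≤ b i) (hD : ∀ i, b i ≤ D) (hD1 : 1 ≤ D) (hρ0 : 0 < ρ)
    (hρ : ρ ≤ 1) (hM : 0 < M) (hρD : ρ ^ M * D ^ L ≤ 1) {l N : ℕ} (h : Chain b ρ M L l N) :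
    l < N ∧ (∏ i ∈ Finset.Ico l N, b i) * D ^ L < 1 ∧
      ∀ k, l ≤ k → k < N → ∏ i ∈ Finset.Ico k N, b i < 1 := by
  induction h with
  | last hlN hg =>
    exact ⟨by omega, hg.prod_mul_pow_lt hM hlN hρ0 hρ hD1 hρD, fun k hk hkN =>
      (hg.1 k hk hkN).trans_le (pow_le_one₀ hρ0.le hρ)⟩
  | @cons l r N hlr hg _ ih =>
    obtain ⟨ih1, ih2, ih3⟩ := ih
    have nonneg : ∀ i j, 0 ≤ ∏ i ∈ Finset.Ico i j, b i := fun i j =>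
      Finset.prod_nonneg fun i _ => h0 i
    have hDL : 1 ≤ D ^ L := one_le_pow₀ hD1
    have mid : ∀ k, r ≤ k → k ≤ r + L → ∏ i ∈ Finset.Ico k N, b i < 1 := by
      intro k hk hk'
      rw [← Finset.prod_Ico_consecutive _ hk' ih1.le]
      have h1 : ∏ i ∈ Finset.Ico k (r + L), b i ≤ D ^ L :=
        (prod_Ico_le_pow h0 hD _ _).trans (pow_le_pow_right₀ hD1 (by omega))
      nlinarith [nonneg (r + L) N]
    have hr := mid r le_rfl (by omega)
    refine ⟨by omega, ?_, fun k hk hkN => ?_⟩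
    · rw [← Finset.prod_Ico_consecutive _ (show l ≤ r by omega) (show r ≤ N by omega)]
      have h1 := hg.prod_mul_pow_lt hM hlr hρ0 hρ hD1 hρD
      have h2 := mul_nonneg (nonneg l r) (by positivity : 0 ≤ D ^ L)
      nlinarith [nonneg r N]
    · rcases lt_or_ge k r with hkr | hkr
      · rw [← Finset.prod_Ico_consecutive _ hkr.le (show r ≤ N by omega)]
        have h1 := (hg.1 k hk hkr).trans_le (pow_le_one₀ hρ0.le hρ)
        nlinarith [nonneg r N, nonneg k r]
      · rcases le_or_gt k (r + L) with hkL | hkL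
        · exact mid k hkr hkL
        · exact ih3 k hkL.le hkN

theorem Chain.prod_initial_lt (h0 : ∀ i, 0 ≤ b i) (hD : ∀ i, b i ≤ D) (hD1 : 1 ≤ D) (hρ0 : 0 < ρ)
    (hρ : ρ ≤ 1) (hM : 0 < M) (hρD : ρ ^ M * D ^ L ≤ 1) {l N : ℕ} (h : Chain b ρ M L l N) :
    ∀ k, l < k → k ≤ N → ∏ i ∈ Finset.Ico l k, b i < 1 := by
  induction h with
  | last hlN hg =>
    exact fun k hk hkN => (hg.2 k hk hkN).trans_le (pow_le_one₀ hρ0.le hρ)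
  | @cons l r N hlr hg _ ih =>
    have nonneg : ∀ i j, 0 ≤ ∏ i ∈ Finset.Ico i j, b i := fun i j =>
      Finset.prod_nonneg fun i _ => h0 i
    have mid : ∀ k, r ≤ k → k ≤ r + L → ∏ i ∈ Finset.Ico l k, b i < 1 := by
      intro k hk hk'
      rw [← Finset.prod_Ico_consecutive _ (show l ≤ r by omega) hk]
      have h1 : ∏ i ∈ Finset.Ico r k, b i ≤ D ^ L :=
        (prod_Ico_le_pow h0 hD _ _).trans (pow_le_pow_right₀ hD1 (by omega))
      have h2 := hg.prod_mul_pow_lt hM hlr hρ0 hρ hD1 hρD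
      nlinarith [nonneg l r]
    intro k hk hkN
    rcases le_or_gt k r with hkr | hkr
    · exact (hg.2 k hk hkr).trans_le (pow_le_one₀ hρ0.le hρ)
    rcases le_or_gt k (r + L) with hkL | hkL
    · exact mid k hkr.le hkL
    · rw [← Finset.prod_Ico_consecutive _ (show l ≤ r + L by omega) hkL.le]
      have h1 := mid (r + L) (by omega) le_rfl
      have h2 := ih k hkL hkN
      nlinarith [nonneg l (r + L), nonneg (r + L) k]

end Chain

/-! ### Property (i) at the next scale -/

section Contraction

variable {ω lam α β : ℝ} {s : ℕ → Scale} {n : ℕ} {θ : UnitAddCircle} {x y : ℝ}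

theorem deriv_p (x : ℝ) : deriv p x = 1 - 2 * x := by
  have h : HasDerivAt p (1 * (1 - x) + x * (-1)) x :=
    (hasDerivAt_id x).mul ((hasDerivAt_id x).const_sub 1)
  rw [h.deriv]; ring

theorem rate_le_one (n : ℕ) : rate n ≤ 1 := by
  have : (1 : ℝ) / 2 ^ (n + 1) ≤ 1 / 2 :=
    one_div_le_one_div_of_le (by norm_num) (le_self_pow₀ (by norm_num) (by omega))
  rw [rate]; linarith

theorem rate_eq (n : ℕ) : rate n = rate (n + 1) + 1 / 2 ^ (n + 2) := by
  rw [rate, rate]; ring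

/-- The derivative of the fibre map, divided by the contraction factor at the scale `n`. -/
noncomputable def slope (ω lam α β : ℝ) (θ : UnitAddCircle) (ξ : ℕ → ℝ) (n i : ℕ) : ℝ :=
  |c lam α β (angle ω θ i) * deriv p (ξ i)| / (3 / 5 : ℝ) ^ rate n

/-- The ratio of the contraction factors at the scales `n` and `n + 1`. -/
noncomputable def rateRatio (n : ℕ) : ℝ := (3 / 5 : ℝ) ^ (1 / 2 ^ (n + 2) : ℝ)

theorem rateRatio_pos (n : ℕ) : 0 < rateRatio n := by rw [rateRatio]; positivity

theorem rateRatio_le_one (n : ℕ) : rateRatio n ≤ 1 :=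
  Real.rpow_le_one (by norm_num) (by norm_num) (by positivity)

theorem slope_nonneg {ξ : ℕ → ℝ} (i : ℕ) : 0 ≤ slope ω lam α β θ ξ n i := by
  rw [slope]; positivity

theorem slope_le (hl : 0 ≤ lam) (hβ : β ∈ Icc (0 : ℝ) 1) {ξ : ℕ → ℝ} {i : ℕ}
    (hξ : ξ i ∈ Icc (0 : ℝ) 1) : slope ω lam α β θ ξ n i ≤ 20 / 3 := by
  have h1 := c_lower (α := α) (θ := angle ω θ i) hl hβ
  have h2 := c_le_four (α := α) (θ := angle ω θ i) hl hβ
  have h3 : |deriv p (ξ i)| ≤ 1 := by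
    rw [deriv_p, abs_le]; constructor <;> linarith [hξ.1, hξ.2]
  have h4 : (3 / 5 : ℝ) ≤ (3 / 5 : ℝ) ^ rate n := by
    conv_lhs => rw [← Real.rpow_one (3 / 5 : ℝ)]
    exact Real.rpow_le_rpow_of_exponent_ge (by norm_num) (by norm_num) (rate_le_one n)
  rw [slope, div_le_iff₀ (by positivity), abs_mul, abs_of_nonneg (by linarith : 0 ≤ c lam α β _)]
  nlinarith [abs_nonneg (deriv p (ξ i))]

theorem prod_slope {ξ : ℕ → ℝ} (k l : ℕ) :
    ∏ i ∈ Finset.Ico k l, slope ω lam α β θ ξ n i =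
      (∏ i ∈ Finset.Ico k l, |c lam α β (angle ω θ i) * deriv p (ξ i)|) /
        (3 / 5 : ℝ) ^ (rate n * ((l - k : ℕ) : ℝ)) := by
  simp only [slope]
  rw [Finset.prod_div_distrib, Finset.prod_const, Nat.card_Ico, Real.rpow_mul (by norm_num),
    Real.rpow_natCast]

theorem rpow_rate_mul (n j : ℕ) : (3 / 5 : ℝ) ^ (rate n * (j : ℝ)) =
    rateRatio n ^ j * (3 / 5 : ℝ) ^ (rate (n + 1) * (j : ℝ)) := by
  rw [rate_eq, add_mul, Real.rpow_add (by norm_num), rateRatio, mul_comm,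
    Real.rpow_mul_natCast (by norm_num) (1 / 2 ^ (n + 2))]

/-- The ratio is (3/5)^{1/2^{n+2}}, so M_n must beat 2^{n+2} times the passage length. It does,
since M_n ≥ K_n²/4 and K_n ≥ 200 · 2^n. The constant 20/3 is 4/(3/5), a bound for the normalised
derivative. -/
theorem pow_rateRatio_mul_le (S : Setting ω lam α s n) :
    rateRatio n ^ (s n).M * (20 / 3) ^ (2 * (s n).K + 20) ≤ 1 := by
  have h1 := S.K_large n le_rfl
  have h2 := S.K_sq n le_rfl
  have h3 := S.two_hundred_le_K le_rfl
  have h4 : 2 ^ (n + 2) * (4 * (2 * (s n).K + 20)) ≤ (s n).M := by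
    have h5 : 1 ≤ 2 ^ n := Nat.one_le_two_pow
    rw [pow_add]
    nlinarith
  have h5 : rateRatio n ^ 2 ^ (n + 2) = 3 / 5 := by
    rw [rateRatio, ← Real.rpow_natCast, ← Real.rpow_mul (by norm_num)]
    push_cast
    rw [one_div_mul_cancel (by positivity), Real.rpow_one]
  have h6 : rateRatio n ^ (s n).M ≤ ((3 / 5) ^ 4) ^ (2 * (s n).K + 20) := by
    refine (pow_le_pow_of_le_one (rateRatio_pos n).le (rateRatio_le_one n) h4).trans ?_
    rw [pow_mul, h5, pow_mul]
  calc _ ≤ ((3 / 5 : ℝ) ^ 4) ^ (2 * (s n).K + 20) * (20 / 3) ^ (2 * (s n).K + 20) := by gcongr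
    _ = ((3 / 5 : ℝ) ^ 4 * (20 / 3)) ^ (2 * (s n).K + 20) := (mul_pow _ _ _).symm
    _ ≤ 1 := pow_le_one₀ (by norm_num) (by norm_num)

theorem goodSegment_slope (hC : Contraction ω lam α s n) (hβ : β ∈ Icc (0 : ℝ) 1) {ξ : ℕ → ℝ}
    {N l : ℕ} (hξ : ∀ i < N, ξ i ∈ segment ℝ (fibre ω lam α β θ x i) (fibre ω lam α β θ y i))
    (hx : fibre ω lam α β θ x l ∈ C) (hy : fibre ω lam α β θ y l ∈ C)
    (hΘ : angle ω θ l ∈ ΘPrev ω s n) (hN : l + hit ω (angle ω θ l) (s n).arc ≤ N) :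
    GoodSegment (slope ω lam α β θ ξ (n + 1)) (rateRatio n) l
      (l + hit ω (angle ω θ l) (s n).arc) := by
  set h := hit ω (angle ω θ l) (s n).arc with hh
  have h1 := (hC β hβ _ hx _ hy _ hΘ h hh).1 (fun i => ξ (l + i)) fun i hi => by
    rw [← fibre_add, ← fibre_add]; exact hξ _ (by omega)
  simp only [← angle_add] at h1
  obtain ⟨h2, h3⟩ := h1
  have shift : ∀ i j, ∏ k ∈ Finset.Ico i j,
      |c lam α β (angle ω θ (l + k)) * deriv p (ξ (l + k))| =
      ∏ k ∈ Finset.Ico (l + i) (l + j), |c lam α β (angle ω θ k) * deriv p (ξ k)| := by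
    intro i j
    rw [Finset.prod_Ico_add (fun k => |c lam α β (angle ω θ k) * deriv p (ξ k)|) i j l,
      add_comm l i, add_comm l j]
  refine ⟨fun k hk hkr => ?_, fun k hk hkr => ?_⟩
  · obtain ⟨i, rfl⟩ : ∃ i, k = l + i := ⟨k - l, by omega⟩
    rw [prod_slope, div_lt_iff₀ (by positivity), ← rpow_rate_mul, ← shift]
    have h4 := h2 i (by omega)
    rwa [show l + h - (l + i) = h - i by omega, Nat.cast_sub (by omega)]
  · obtain ⟨i, rfl⟩ : ∃ i, k = l + i := ⟨k - l, by omega⟩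
    rw [prod_slope, div_lt_iff₀ (by positivity), ← rpow_rate_mul]
    have h4 := h3 i ⟨by omega, by omega⟩
    rw [Finset.range_eq_Ico, shift, add_zero] at h4
    rwa [show l + i - l = i by omega]

/-- Decomposition at the visits to I_n before the first visit to I_{n+1}: the stretch up to a visit
is a good segment by (i) at scale n, and the following passage has length 2K_n + 20. Both orbits are
in C at the start of every stretch. Points outside C occur only over G_{n-1} or during a passage,
hence over G_n. -/
theorem chain_slope (S : Setting ω lam α s (n + 1)) (h : PropsIToIII ω lam α s n)
    (hstd : IsStandardSucc ω α s n) (hβ : β ∈ Icc (0 : ℝ) 1) {N : ℕ}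
    (hN : angle ω θ N ∈ (s (n + 1)).arc) (hN' : ∀ j < N, angle ω θ j ∉ (s (n + 1)).arc)
    {ξ : ℕ → ℝ}
    (hξ : ∀ i < N, ξ i ∈ segment ℝ (fibre ω lam α β θ x i) (fibre ω lam α β θ y i)) :
    ∀ d l : ℕ, l + d = N → fibre ω lam α β θ x l ∈ C → fibre ω lam α β θ y l ∈ C →
      angle ω θ l ∈ ΘPrev ω s n → (∀ j < (s n).M, angle ω θ (l + j) ∉ (s n).arc) →
      Chain (slope ω lam α β θ ξ (n + 1)) (rateRatio n) (s n).M (2 * (s n).K + 20) l N ∧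
      ∀ k, l ≤ k → k ≤ N → fibre ω lam α β θ x k ∉ C → angle ω θ k ∈ GPrev ω s (n + 1) := by
  have S' := S.mono n.le_succ
  have hM := S'.fifty_mul_K_le_M (le_refl n)
  have hK := S'.two_hundred_le_K (le_refl n)
  have hsub : (s (n + 1)).arc ⊆ (s n).arc := arc_mono (S.nested n (n + 1) n.le_succ le_rfl)
  intro d
  induction d using Nat.strong_induction_on with
  | _ d ih =>
    intro l hl hx hy hΘ hfree
    have h1 := angle_hit_mem (S'.dense n le_rfl (angle ω θ l))
    have hrM : (s n).M ≤ hit ω (angle ω θ l) (s n).arc :=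
      le_hit (S'.dense n le_rfl _) fun j hj => by rw [← angle_add]; exact hfree j hj
    have hrN : l + hit ω (angle ω θ l) (s n).arc ≤ N := by
      have : angle ω (angle ω θ l) d ∈ (s n).arc := by rw [← angle_add, hl]; exact hsub hN
      have := hit_le this
      omega
    have hgood := goodSegment_slope h.i.1 hβ hξ hx hy hΘ hrN
    have hG := (h.i.1 β hβ _ hx _ hy _ hΘ _ rfl).2.1
    have hnot : angle ω θ l ∉ (s n).arc := by
      have := hfree 0 (by omega); simpa using this
    have hxr := h.iii β hβ _ hx _ hnot
    have hyr := h.iii β hβ _ hy _ hnot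
    set t := hit ω (angle ω θ l) (s n).arc
    have hG' : ∀ k, l ≤ k → k ≤ l + t → fibre ω lam α β θ x k ∉ C →
        angle ω θ k ∈ GPrev ω s (n + 1) := by
      intro k hk hk' hxk
      obtain ⟨i, rfl⟩ : ∃ i, k = l + i := ⟨k - l, by omega⟩
      rw [fibre_add] at hxk
      rw [angle_add]
      exact GPrev_mono n.le_succ (hG i (by omega) hxk)
    rw [← angle_add] at h1
    rw [← fibre_add] at hxr hyr
    rcases eq_or_lt_of_le hrN with heq | hlt
    · rw [heq] at hgood hG'
      exact ⟨Chain.last (by omega) hgood, hG'⟩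
    have hx2 := S'.fibre_mem_C_of_passage h.ii h.i.2 hstd hβ h1 (hN' _ hlt)
      (C_subset_mid hxr) (C_le hxr)
    have hy2 := S'.fibre_mem_C_of_passage h.ii h.i.2 hstd hβ h1 (hN' _ hlt)
      (C_subset_mid hyr) (C_le hyr)
    have hΘ2 := Setting.angle_passage h.i.2 h1
    -- The absence of returns before 7M_n serves twice: the passage ends by time N, and the next
    -- good segment has length at least M_n.
    have hfree2 : ∀ i, i ≠ 0 → i ≤ 7 * (s n).M → angle ω θ (l + t + i) ∉ (s n).arc :=
      fun i hi hi' => by rw [angle_add]; exact S'.angle_notMem_arc_of_mem h1 hi hi'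
    rw [← fibre_add] at hx2 hy2
    rw [← angle_add] at hΘ2
    have htN : l + t + (2 * (s n).K + 20) ≤ N := by
      by_contra! hcon
      have := hfree2 (N - (l + t)) (by omega) (by omega)
      rw [Nat.add_sub_cancel' hlt.le] at this
      exact this (hsub hN)
    obtain ⟨hc, hg⟩ := ih (N - (l + t + (2 * (s n).K + 20))) (by omega)
      (l + t + (2 * (s n).K + 20)) (by omega) hx2 hy2 hΘ2 fun j hj => by
        rw [add_assoc (l + t)]; exact hfree2 _ (by omega) (by omega)
    refine ⟨Chain.cons (by omega) hgood hc, fun k hk hkN hxk => ?_⟩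
    rcases le_or_gt k (l + t) with hkt | hkt
    · exact hG' k hk hkt hxk
    rcases le_or_gt k (l + t + (2 * (s n).K + 20)) with hkt' | hkt'
    · obtain ⟨i, rfl⟩ : ∃ i, k = l + t + i := ⟨k - (l + t), by omega⟩
      rw [← translate_zero (ω := ω) (I := (s n).arc)] at h1
      have h5 := angle_mem_translate_of_mem (k := i) h1
      rw [angle_add]
      exact mem_GPrev_succ h5 (by omega) (by omega)
    · exact hg k hkt'.le hkN hxk

/-- For a quadratic map the mean value point is exactly the midpoint, so the contraction of
differences is the product estimate with ξ_i the midpoints. -/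
theorem fibre_sub_fibre (k : ℕ) :
    |fibre ω lam α β θ x k - fibre ω lam α β θ y k| =
      (∏ i ∈ Finset.range k, |c lam α β (angle ω θ i) *
        deriv p ((fibre ω lam α β θ x i + fibre ω lam α β θ y i) / 2)|) * |x - y| := by
  induction k with
  | zero => simp
  | succ k ih =>
    rw [Finset.prod_range_succ, mul_right_comm, ← ih, ← abs_mul, fibre_succ, fibre_succ, deriv_p]
    congr 1
    simp only [p]
    ring

theorem segment_subset_unit {x y z : ℝ} (hx : x ∈ Icc (0 : ℝ) 1) (hy : y ∈ Icc (0 : ℝ) 1)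
    (hz : z ∈ segment ℝ x y) : z ∈ Icc (0 : ℝ) 1 :=
  (convex_Icc (0 : ℝ) 1).segment_subset hx hy hz

theorem midpoint_mem_segment' (x y : ℝ) : (x + y) / 2 ∈ segment ℝ x y :=
  ⟨1 / 2, 1 / 2, by norm_num, by norm_num, by norm_num, by simp only [smul_eq_mul]; ring⟩

theorem contraction_succ (S : Setting ω lam α s (n + 1)) (h : PropsIToIII ω lam α s n)
    (hstd : IsStandardSucc ω α s n) : Contraction ω lam α s (n + 1) := by
  have S' := S.mono n.le_succ
  have hM := S'.fifty_mul_K_le_M (le_refl n)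
  have hK := S'.two_hundred_le_K (le_refl n)
  intro β hβ x hx y hy θ hΘ N hN
  have hNmem : angle ω θ N ∈ (s (n + 1)).arc := hN ▸ angle_hit_mem (S.dense _ le_rfl θ)
  have hN' : ∀ j < N, angle ω θ j ∉ (s (n + 1)).arc := fun j hj =>
    angle_notMem_of_lt_hit (hN ▸ hj)
  have hfree : ∀ j < (s n).M, angle ω θ (0 + j) ∉ (s n).arc := by
    intro j hj hmem
    rw [zero_add, angle_mem_iff] at hmem
    exact hΘ (mem_iUnion₂.2 ⟨n, le_refl n, mem_iUnion₂.2 ⟨-j, ⟨by omega, by omega⟩, hmem⟩⟩)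
  have chain := fun (ξ : ℕ → ℝ) hξ => chain_slope (ξ := ξ) S h hstd hβ hNmem hN' hξ N 0 (by omega)
    hx hy (by simpa using ΘPrev_antitone S' hΘ) hfree
  have hx1 := mid_subset (C_subset_mid hx)
  have hy1 := mid_subset (C_subset_mid hy)
  have prods : ∀ ξ : ℕ → ℝ,
      (∀ i < N, ξ i ∈ segment ℝ (fibre ω lam α β θ x i) (fibre ω lam α β θ y i)) →
        (∀ k < N, ∏ i ∈ Finset.Ico k N, |c lam α β (angle ω θ i) * deriv p (ξ i)|
          < (3 / 5 : ℝ) ^ (rate (n + 1) * ((N : ℝ) - k))) ∧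
        (∀ k ∈ Icc 1 N, ∏ i ∈ Finset.range k, |c lam α β (angle ω θ i) * deriv p (ξ i)|
          < (3 / 5 : ℝ) ^ (rate (n + 1) * (k : ℝ))) := by
    intro ξ hξ
    -- The chain lemmas bound the slope at every index, but ξ is constrained only below N; any value
    -- in [0, 1] will do beyond.
    let ξ' : ℕ → ℝ := fun i => if i < N then ξ i else 0
    have hξ' : ∀ i < N, ξ' i = ξ i := fun i hi => if_pos hi
    have hunit : ∀ i, ξ' i ∈ Icc (0 : ℝ) 1 := by
      intro i
      by_cases hi : i < N
      · rw [hξ' i hi]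
        exact segment_subset_unit (fibre_mem S.lam_nonneg hβ hx1 i)
          (fibre_mem S.lam_nonneg hβ hy1 i) (hξ i hi)
      · simp only [ξ', if_neg hi]; norm_num
    have hc := (chain ξ' fun i hi => by rw [hξ' i hi]; exact hξ i hi).1
    have hle : ∀ i, slope ω lam α β θ ξ' (n + 1) i ≤ 20 / 3 := fun i =>
      slope_le S.lam_nonneg hβ (hunit i)
    have h1 := hc.prod_final_lt slope_nonneg hle (by norm_num) (rateRatio_pos n)
      (rateRatio_le_one n) (by omega) (pow_rateRatio_mul_le S')
    have h2 := hc.prod_initial_lt slope_nonneg hle (by norm_num) (rateRatio_pos n)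
      (rateRatio_le_one n) (by omega) (pow_rateRatio_mul_le S')
    have hcongr : ∀ k l, l ≤ N →
        ∏ i ∈ Finset.Ico k l, |c lam α β (angle ω θ i) * deriv p (ξ i)| =
        ∏ i ∈ Finset.Ico k l, |c lam α β (angle ω θ i) * deriv p (ξ' i)| := fun k l hl =>
      Finset.prod_congr rfl fun i hi => by
        rw [hξ' i ((Finset.mem_Ico.1 hi).2.trans_le hl)]
    refine ⟨fun k hk => ?_, fun k hk => ?_⟩
    · have h3 := h1.2.2 k (Nat.zero_le k) hk
      rw [prod_slope, div_lt_one (by positivity), Nat.cast_sub hk.le] at h3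
      rwa [hcongr k N le_rfl]
    · have h3 := h2 k hk.1 hk.2
      rw [prod_slope, div_lt_one (by positivity), Nat.sub_zero] at h3
      rwa [Finset.range_eq_Ico, hcongr 0 k hk.2]
  refine ⟨prods, fun k hk => ?_, fun hne k hk => ?_⟩
  · exact (chain _ fun i _ => midpoint_mem_segment' _ _).2 k (Nat.zero_le k) hk
  · rw [fibre_sub_fibre]
    exact mul_lt_mul_of_pos_right ((prods _ fun i _ => midpoint_mem_segment' _ _).2 k hk)
      (abs_pos.2 (sub_ne_zero.2 hne))

end Contraction

/-! ### Property (iv) -/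

section PropIV

variable {ω lam α β : ℝ} {s : ℕ → Scale} {n : ℕ} {θ : UnitAddCircle} {x : ℝ}

/-- The definition of `MC` with the bound 2K_n - 2 leaves the exponent 2K_n - 6 after the summand 4
is removed. This is the growth budget of the recovery. -/
theorem p_V_of_mem_B (hK : 200 ≤ (s n).K) (hβ : β ∈ B s n) :
    1 / 150 ≤ p (V β) * (5 / 4) ^ (2 * (s n).K - 6) := by
  obtain ⟨⟨h0, h1⟩, hMC⟩ := hβ
  have hV : 0 < V β * (1 - V β) := by
    have : 0 < V β := by rw [V]; linarith
    have : 0 < 1 - V β := by rw [V]; linarith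
    positivity
  have hlog : (0 : ℝ) < Real.log (5 / 4) := Real.log_pos (by norm_num)
  set X := Real.log (1 / (150 * V β * (1 - V β)))
  have h2 : X / Real.log (5 / 4) + 4 ≤ (MC β : ℝ) :=
    (Nat.le_ceil _).trans (Nat.cast_le.2 (le_max_right _ _))
  have h3 : MC β ≤ 2 * (s n).K - 2 := by omega
  have h4 : (MC β : ℝ) ≤ ((2 * (s n).K - 6 : ℕ) : ℝ) + 4 := by
    have : MC β ≤ 2 * (s n).K - 6 + 4 := by omega
    exact_mod_cast this
  have h5 : X ≤ ((2 * (s n).K - 6 : ℕ) : ℝ) * Real.log (5 / 4) := by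
    rw [← div_le_iff₀ hlog]; linarith
  rw [← Real.log_pow, Real.log_le_log_iff (by rw [mul_assoc]; positivity) (by positivity),
    div_le_iff₀ (by rw [mul_assoc]; positivity)] at h5
  rw [p]
  nlinarith

/-- At scale 0 only `I₀` and `I₀ + ω` must be avoided, and the gap bound suffices; later scales have
the property by being standard. -/
theorem translate_subset_ΘPrev (S : Setting ω lam α s n)
    (hstd : ∀ k < n, IsStandardSucc ω α s k) {k : ℕ} (hk : k ≤ n) {m : ℤ}
    (hm : m ∈ Icc (-1 : ℤ) 21) :
    translate ω (s k).arc (2 * ((s k).K : ℤ) + m) ⊆ ΘPrev ω s k := by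
  cases k with
  | zero =>
    have hM := S.fifty_mul_K_le_M (Nat.zero_le n)
    have hK := S.two_hundred_le_K (Nat.zero_le n)
    have hm1 := hm.1
    have hm2 := hm.2
    intro θ hθ h
    rcases h with h | h
    · rw [← translate_zero (ω := ω) (I := (s 0).arc)] at h
      have := S.eq_of_mem le_rfl (Nat.zero_le n) hθ h (by rw [abs_le]; constructor <;> omega)
      omega
    · have := S.eq_of_mem le_rfl (Nat.zero_le n) hθ h (by rw [abs_le]; constructor <;> omega)
      omega
  | succ k => exact (hstd k hk).wide m hm

theorem propIV_of_scales (S : Setting ω lam α s n) (h : PropsIToIII ω lam α s n)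
    (hprev : ∀ k < n, PropsIToIII ω lam α s k ∧ IsStandardSucc ω α s k) :
    PropIV ω lam α s n := by
  intro β hβ x hx k hk θ hθ hnot hx'
  have hβ' : β ∈ Icc (0 : ℝ) 1 := ⟨hβ.1.1, hβ.1.2.le⟩
  have S' := S.mono hk
  have hK := S'.two_hundred_le_K (le_refl k)
  have hII : PropII ω lam α s k := by
    rcases eq_or_lt_of_le hk with rfl | hlt
    · exact h.ii
    · exact (hprev k hlt).1.ii
  -- A start in I_k + eω with |e| ≤ 1 shifts the times 0, …, 20 by e, whence the range -1, …, 21 for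
  -- standard scales.
  have hwide : ∀ e : ℤ, -1 ≤ e → e ≤ 1 → θ ∈ translate ω (s k).arc e →
      ∀ i ≤ 20, angle ω θ (2 * (s k).K + i) ∈ ΘPrev ω s k := by
    intro e he he' hθe i hi
    have h1 := angle_mem_translate_of_mem (k := 2 * (s k).K + i) hθe
    refine translate_subset_ΘPrev S (fun j hj => (hprev j hj).2) hk (m := e + i)
      ⟨by omega, by omega⟩ ?_
    convert h1 using 2
    push_cast; ring
  obtain ⟨v, hv, hc⟩ : ∃ v : ℝ, 1 / 150 ≤ p v * (5 / 4) ^ (2 * (s k).K - 6) ∧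
      ∀ j : ℕ, j ≤ 2 → θ ∈ translate ω (s k).arc (1 - j) → c lam α β (angle ω θ j) ≤ 4 * v := by
    rcases eq_or_lt_of_le hk with rfl | hlt
    · exact ⟨V β, p_V_of_mem_B hK hβ, fun j _ _ => c_le_V S.lam_nonneg hβ'⟩
    · refine ⟨Setting.farBound (s k).K, Setting.p_farBound hK, fun j hj hθj => ?_⟩
      have hstd := (hprev k hlt).2
      have hθj' : θ ∉ translate ω (s (k + 1)).arc (1 - j) := by
        have h1 := hnot (k + 1) k.lt_succ_self hlt
        simp only [nbhd, mem_union, not_or] at h1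
        interval_cases j
        · exact h1.2
        · simpa using h1.1.2
        · exact h1.1.1
      refine S'.c_le_farBound hβ' hstd.lo_eq hstd.hi_eq ?_ ?_
      · rwa [angle_mem_translate]
      · rwa [angle_mem_translate]
  rcases hθ with (hθ | hθ) | hθ
  · have hw := hwide (-1) le_rfl (by norm_num) hθ
    exact ⟨hw, S'.fibre_mem_C_of_mem_neg_one hII hβ' hθ hx (hc 2 le_rfl hθ) hv le_rfl
      (by omega) hw⟩
  · have hθ0 := hθ
    rw [← translate_zero (ω := ω) (I := (s k).arc)] at hθ0
    have hw := hwide 0 (by norm_num) (by norm_num) hθ0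
    refine ⟨hw, ?_⟩
    rcases eq_or_lt_of_le hk with rfl | hlt
    -- Here x ≤ 2/5 is not available, but one step brings x below V_β, and β ∈ B_n controls the
    -- distance of V_β to 1.
    · obtain ⟨T, hT⟩ : ∃ T, 2 * (s k).K = 1 + T := ⟨2 * (s k).K - 1, by omega⟩
      rw [hT, add_assoc, fibre_add, fibre_one]
      have hV := c_le_V (θ := θ) (α := α) S.lam_nonneg hβ'
      have h1 : c lam α β θ * p x ∈ Icc (1 / 100 : ℝ) (V β) := by
        have h2 := c_lower (α := α) (θ := θ) S.lam_nonneg hβ'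
        have h3 := p_lower_of_mem_mid hx
        have h4 := p_le_quarter (x := x)
        exact ⟨by nlinarith, by nlinarith⟩
      refine S'.fibre_mem_C_of_mem_one hII hβ' ?_ h1 (V_le_one hβ') (c_le_V S.lam_nonneg hβ')
        (p_V_of_mem_B hK hβ) (p_V_of_mem_B hK hβ) (by omega) (by omega) fun i hi => ?_
      · exact angle_mem_translate_of_mem (k := 1) hθ0
      · rw [← angle_add, ← add_assoc, ← hT]; exact hw i hi
    · exact S'.fibre_mem_C_of_mem_zero hII hβ' hθ hx (hx' hlt hθ)
        (hc 1 (by norm_num) (by simpa using hθ)) hv (by omega) (by omega) hw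
  · have hw := hwide 1 (by norm_num) le_rfl hθ
    refine ⟨hw, S'.fibre_mem_C_of_mem_one hII hβ' hθ hx (by norm_num) ?_
      (Setting.p_mid_mul_pow _) hv (by omega) (by omega) hw⟩
    simpa using hc 0 (by norm_num) (by simpa using hθ)

end PropIV

/-! ### The sizes of the scales -/

/-- The largeness conditions on a time `K` used in passing from one scale to the next. -/
structure LargeTime (κ τ : ℝ) (K : ℕ) : Prop where
  growth : 20 * (K : ℝ) ^ 2 + 20 ≤ (5 / 4 : ℝ) ^ (K / (4 * τ) : ℝ)
  gap : 2 * (14 : ℝ) ^ τ * (4 / 5 : ℝ) ^ ((K : ℝ) / 2) ≤ κ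
  two_hundred_le : 200 ≤ K

/-- The largeness conditions on the parameter `λ`. -/
structure LargeParameter (κ τ lam : ℝ) : Prop where
  one_le : 1 ≤ lam
  outside : 2500 ≤ 4 * lam * (lam ^ (-(1 / 7) : ℝ)) ^ 4
  le_kappa : lam ^ (-(1 / 7) : ℝ) ≤ κ / 2
  le_quarter : lam ^ (-(1 / 7) : ℝ) ≤ 1 / 4
  far : 320 ≤ 4 * κ ^ 2 * lam
  gap : 4 * lam ^ (-(1 / 7) : ℝ) * (7 * lam ^ (1 / (14 * τ))) ^ τ ≤ κ
  time : ∀ K : ℕ, ⌊lam ^ (1 / (28 * τ))⌋₊ ≤ K → LargeTime κ τ K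

open Filter Topology in
theorem eventually_largeTime {κ τ : ℝ} (hκ : 0 < κ) (hτ : 1 ≤ τ) :
    ∀ᶠ K : ℕ in atTop, LargeTime κ τ K := by
  have hr : 1 < (5 / 4 : ℝ) ^ (1 / (4 * τ)) := Real.one_lt_rpow (by norm_num) (by positivity)
  have h1 := (tendsto_pow_const_div_const_pow_of_one_lt 2 hr).eventually_lt_const
    (show (0 : ℝ) < 1 / 40 by norm_num)
  have h2 := (tendsto_pow_const_div_const_pow_of_one_lt 0 hr).eventually_lt_const
    (show (0 : ℝ) < 1 / 40 by norm_num)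
  have hq : (4 / 5 : ℝ) ^ (1 / 2 : ℝ) < 1 := Real.rpow_lt_one (by norm_num) (by norm_num)
    (by norm_num)
  have h3 := ((tendsto_pow_atTop_nhds_zero_of_lt_one (by positivity) hq).const_mul
    (2 * (14 : ℝ) ^ τ)).eventually_lt_const (by simpa using hκ)
  filter_upwards [h1, h2, h3, eventually_ge_atTop 200] with K h1 h2 h3 h4
  have hpos : 0 < ((5 / 4 : ℝ) ^ (1 / (4 * τ))) ^ K := by positivity
  rw [div_lt_iff₀ hpos] at h1 h2
  refine ⟨?_, ?_, h4⟩
  · rw [show (K / (4 * τ) : ℝ) = 1 / (4 * τ) * K by ring, Real.rpow_mul_natCast (by norm_num)]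
    rw [pow_zero] at h2
    linarith
  · rw [show (K : ℝ) / 2 = 1 / 2 * K by ring, Real.rpow_mul_natCast (by norm_num)]
    exact h3.le

open Filter Topology in
theorem eventually_largeParameter {κ τ : ℝ} (hκ : 0 < κ) (hτ : 1 ≤ τ) :
    ∀ᶠ lam : ℝ in atTop, LargeParameter κ τ lam := by
  have hτ0 : 0 < τ := by linarith
  have h1 := (tendsto_rpow_atTop (show (0 : ℝ) < 3 / 7 by norm_num)).eventually_ge_atTop 625
  have h2 := (tendsto_rpow_neg_atTop (show (0 : ℝ) < 1 / 7 by norm_num)).eventually_lt_const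
    (show (0 : ℝ) < min (κ / 2) (1 / 4) by positivity)
  have h3 := ((tendsto_rpow_neg_atTop (show (0 : ℝ) < 1 / 14 by norm_num)).const_mul
    (4 * 7 ^ τ)).eventually_lt_const (by simpa using hκ)
  obtain ⟨K₀, hK₀⟩ := eventually_atTop.1 (eventually_largeTime hκ hτ)
  have h4 := (tendsto_nat_floor_atTop.comp (tendsto_rpow_atTop
    (show (0 : ℝ) < 1 / (28 * τ) by positivity))).eventually_ge_atTop K₀
  filter_upwards [h1, h2, h3, h4, eventually_ge_atTop 1, eventually_ge_atTop (320 / (4 * κ ^ 2))]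
    with lam h1 h2 h3 h4 h5 h6
  have hl : 0 < lam := by linarith
  refine ⟨h5, ?_, (h2.trans_le (min_le_left _ _)).le, (h2.trans_le (min_le_right _ _)).le, ?_, ?_,
    fun K hK => hK₀ K (le_trans h4 hK)⟩
  · have : lam * (lam ^ (-(1 / 7) : ℝ)) ^ 4 = lam ^ (3 / 7 : ℝ) := by
      rw [← Real.rpow_mul_natCast hl.le]
      nth_rewrite 1 [← Real.rpow_one lam]
      rw [← Real.rpow_add hl]
      norm_num
    nlinarith
  · rw [div_le_iff₀ (by positivity)] at h6; linarith
  · have h7 : 4 * lam ^ (-(1 / 7) : ℝ) * (7 * lam ^ (1 / (14 * τ))) ^ τ =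
        4 * 7 ^ τ * lam ^ (-(1 / 14) : ℝ) := by
      rw [Real.mul_rpow (by norm_num) (by positivity), ← Real.rpow_mul hl.le,
        show 1 / (14 * τ) * τ = 1 / 14 by field_simp,
        show (-(1 / 14) : ℝ) = -(1 / 7) + 1 / 14 by norm_num, Real.rpow_add hl]
      ring
    rw [h7]; exact h3.le

theorem Diophantine.gapBound {ω κ τ : ℝ} (hω : Diophantine ω κ τ) (hτ : 0 ≤ τ) {S : Scale} {R : ℤ}
    {r : ℝ} (hS : S.lo ≤ S.hi) (hR : (R : ℝ) ≤ r) (h : 2 * (S.hi - S.lo) * r ^ τ ≤ κ) :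
    GapBound ω S R := by
  intro q m hq hqR
  refine lt_of_le_of_lt ?_ (hω q hq m)
  have h1 : (0 : ℝ) < |(q : ℝ)| := abs_pos.2 (Int.cast_ne_zero.2 hq)
  have h2 : |(q : ℝ)| ≤ r := by
    have : ((|q| : ℤ) : ℝ) ≤ (R : ℝ) := Int.cast_le.2 hqR
    rw [Int.cast_abs] at this
    linarith
  rw [le_div_iff₀ (by positivity)]
  refine le_trans ?_ h
  have h3 : |(q : ℝ)| ^ τ ≤ r ^ τ := Real.rpow_le_rpow h1.le h2 hτ
  have h4 : 0 ≤ S.hi - S.lo := by linarith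
  gcongr

namespace Sizes

variable {ω κ τ lam α : ℝ} {s : ℕ → Scale} {n : ℕ}

theorem rpow_half_eq (τ : ℝ) (K : ℕ) : (5 / 4 : ℝ) ^ (K / (2 * τ) : ℝ) =
    ((5 / 4 : ℝ) ^ (K / (4 * τ) : ℝ)) ^ 2 := by
  rw [← Real.rpow_mul_natCast (by norm_num)]
  congr 1
  push_cast
  field_simp
  norm_num

theorem K_facts (hs : Sizes ω τ lam α s n) (hp : LargeParameter κ τ lam) :
    ∀ k ≤ n, 200 * 2 ^ k ≤ (s k).K ∧ LargeTime κ τ (s k).K := by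
  have h0 : ∀ k ≤ n, ⌊lam ^ (1 / (28 * τ))⌋₊ ≤ (s k).K ∧ 200 * 2 ^ k ≤ (s k).K := by
    intro k
    induction k with
    | zero =>
      intro _
      have h1 : (s 0).K = ⌊lam ^ (1 / (28 * τ))⌋₊ := by rw [hs.zero]; rfl
      exact ⟨h1.ge, by simpa using (hp.time _ h1.ge).two_hundred_le⟩
    | succ k ih =>
      intro hk
      obtain ⟨h1, h2⟩ := ih (Nat.le_of_succ_le hk)
      have h3 := (hp.time _ h1).growth
      have h4 := (hs.K_mem k hk).1
      have h5 : 2 * ((s k).K : ℝ) ≤ (s (k + 1)).K := by nlinarith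
      have h6 : 2 * (s k).K ≤ (s (k + 1)).K := by exact_mod_cast h5
      exact ⟨by omega, by rw [pow_succ]; omega⟩
  exact fun k hk => ⟨(h0 k hk).2, hp.time _ (h0 k hk).1⟩

/-- M_k is comparable to K_k², since both come from one quantity and its square, up to rounding or
factors of 2. The lower bound on M_k feeds the contraction, the upper bound the search for the next
scale. -/
theorem M_facts (hs : Sizes ω τ lam α s n) (hp : LargeParameter κ τ lam) {k : ℕ} (hk : k ≤ n) :
    (s k).K ^ 2 ≤ 4 * (s k).M ∧ (s k).M ≤ 2 * (s k).K ^ 2 := by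
  cases k with
  | zero =>
    have hl : 0 ≤ lam := by linarith [hp.one_le]
    have hK := (hs.K_facts hp 0 hk).2.two_hundred_le
    have hK' : (s 0).K = ⌊lam ^ (1 / (28 * τ))⌋₊ := by rw [hs.zero]; rfl
    have hM' : (s 0).M = ⌊lam ^ (1 / (14 * τ))⌋₊ := by rw [hs.zero]; rfl
    have hy : lam ^ (1 / (14 * τ)) = (lam ^ (1 / (28 * τ))) ^ 2 := by
      rw [← Real.rpow_mul_natCast hl]
      congr 1
      push_cast
      field_simp
      norm_num
    set y := lam ^ (1 / (28 * τ))
    have hy0 : 0 ≤ y := by positivity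
    have h1 : ((s 0).K : ℝ) ≤ y := by rw [hK']; exact Nat.floor_le hy0
    have h2 : y < (s 0).K + 1 := by rw [hK']; exact Nat.lt_floor_add_one y
    have h3 : ((s 0).M : ℝ) ≤ y ^ 2 := by rw [hM', hy]; exact Nat.floor_le (by positivity)
    have h4 : y ^ 2 < (s 0).M + 1 := by rw [hM', hy]; exact Nat.lt_floor_add_one _
    have h5 : ((s 0).K : ℝ) ^ 2 < (s 0).M + 1 := by nlinarith
    have h6 : ((s 0).M : ℝ) < ((s 0).K + 1) ^ 2 := by nlinarith
    have h7 : (s 0).K ^ 2 < (s 0).M + 1 := by exact_mod_cast h5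
    have h8 : (s 0).M < ((s 0).K + 1) ^ 2 := by exact_mod_cast h6
    exact ⟨by omega, by nlinarith⟩
  | succ k =>
    have hK := hs.K_mem k hk
    have hM := hs.M_mem k hk
    rw [rpow_half_eq] at hM
    set X := (5 / 4 : ℝ) ^ ((s k).K / (4 * τ) : ℝ)
    have hX : 0 < X := by positivity
    have h1 : ((s (k + 1)).K : ℝ) ^ 2 ≤ 4 * (s (k + 1)).M := by nlinarith [hK.1, hK.2, hM.1]
    have h2 : ((s (k + 1)).M : ℝ) ≤ 2 * (s (k + 1)).K ^ 2 := by nlinarith [hK.1, hM.2]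
    exact ⟨by exact_mod_cast h1, by exact_mod_cast h2⟩

theorem lo_lt_hi (hs : Sizes ω τ lam α s n) (hl : 0 < lam) {k : ℕ} (hk : k ≤ n) :
    (s k).lo < (s k).hi := by
  cases k with
  | zero =>
    rw [hs.zero]
    have : 0 < lam ^ (-(1 / 7) : ℝ) := by positivity
    simp only [scaleZero]; linarith
  | succ k =>
    have h1 := hs.length k hk
    have h2 : (0 : ℝ) < (4 / 5) ^ (s k).K := by positivity
    linarith

/-- The exponents of M_k are chosen so that M_k^τ grows at most like the inverse square root of
|I_k|; the product with |I_k| is still small. -/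
theorem gapBound (hs : Sizes ω τ lam α s n) (hp : LargeParameter κ τ lam) (hτ : 1 ≤ τ)
    (hω : Diophantine ω κ τ) {k : ℕ} (hk : k ≤ n) : GapBound ω (s k) (7 * ((s k).M : ℤ)) := by
  have hτ0 : 0 < τ := by linarith
  have hl : 0 < lam := by linarith [hp.one_le]
  have hlt := (hs.lo_lt_hi hl hk).le
  cases k with
  | zero =>
    have hM : ((s 0).M : ℝ) ≤ lam ^ (1 / (14 * τ)) := by
      rw [hs.zero]; exact Nat.floor_le (by positivity)
    refine hω.gapBound hτ0.le hlt (r := 7 * lam ^ (1 / (14 * τ))) (by push_cast; linarith) ?_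
    have h1 : 2 * ((s 0).hi - (s 0).lo) = 4 * lam ^ (-(1 / 7) : ℝ) := by
      rw [hs.zero]; simp only [scaleZero]; ring
    rw [h1]; exact hp.gap
  | succ k =>
    have hM := (hs.M_mem k hk).2
    refine hω.gapBound hτ0.le hlt (r := 14 * (5 / 4 : ℝ) ^ ((s k).K / (2 * τ) : ℝ))
      (by push_cast; linarith) ?_
    rw [hs.length k hk]
    refine le_trans (le_of_eq ?_) (hs.K_facts hp k (Nat.le_of_succ_le hk)).2.gap
    rw [Real.mul_rpow (by norm_num) (by positivity), ← Real.rpow_mul (by norm_num),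
      show ((s k).K : ℝ) / (2 * τ) * τ = (s k).K / 2 by field_simp]
    have h1 : (4 / 5 : ℝ) ^ (s k).K = (4 / 5 : ℝ) ^ (((s k).K : ℝ) / 2) *
        (4 / 5 : ℝ) ^ (((s k).K : ℝ) / 2) := by
      rw [← Real.rpow_add (by norm_num), add_halves, Real.rpow_natCast]
    have h2 : (4 / 5 : ℝ) ^ (((s k).K : ℝ) / 2) * (5 / 4 : ℝ) ^ (((s k).K : ℝ) / 2) = 1 := by
      rw [← Real.mul_rpow (by norm_num) (by norm_num)]; norm_num
    rw [h1]
    linear_combination 2 * (14 : ℝ) ^ τ * (4 / 5 : ℝ) ^ (((s k).K : ℝ) / 2) * h2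

theorem interval_subset (hs : Sizes ω τ lam α s n) {j k : ℕ} (hjk : j ≤ k) (hk : k ≤ n) :
    (s k).interval ⊆ (s j).interval := by
  induction k, hjk using Nat.le_induction with
  | base => exact Subset.rfl
  | succ k _ ih => exact (hs.nested k hk).trans (ih (Nat.le_of_succ_le hk))

theorem setting (hs : Sizes ω τ lam α s n) (hp : LargeParameter κ τ lam) (hκ : 0 < κ)
    (hτ : 1 ≤ τ) (hω : Diophantine ω κ τ) (hα : α ∈ A₀ ω lam) : Setting ω lam α s n := by
  have hl : 0 < lam := by linarith [hp.one_le]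
  have hh : 0 < lam ^ (-(1 / 7) : ℝ) := by positivity
  have hα' : |α - ω| ≤ lam ^ (-(1 / 7) : ℝ) / 2 := by
    have h1 : lam ^ (-(2 / 5) : ℝ) ≤ lam ^ (-(1 / 7) : ℝ) :=
      Real.rpow_le_rpow_of_exponent_le hp.one_le (by norm_num)
    have h2 : 0 < lam ^ (-(2 / 3) : ℝ) := by positivity
    rw [abs_le]
    exact ⟨by linarith [hα.1], by linarith [hα.2]⟩
  have hlo : (s 0).lo = -lam ^ (-(1 / 7) : ℝ) := by rw [hs.zero]; rfl
  have hhi : (s 0).hi = lam ^ (-(1 / 7) : ℝ) := by rw [hs.zero]; rfl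
  refine ⟨hl.le, fun β hβ θ hθ => c_le_of_outside hl.le hh hα' hp.outside hlo hhi hβ hθ,
    fun β hβ t ht ε hε htε => ?_, fun j k hjk hk => hs.interval_subset hjk hk,
    fun k hk => hs.gapBound hp hτ hω hk, fun k hk => (hs.K_facts hp k hk).1,
    fun k hk => (hs.M_facts hp hk).1,
    fun k hk θ => exists_angle_mem (hω.irrational hκ) (hs.lo_lt_hi hl hk) θ⟩
  refine c_le_of_far hl.le hκ hα' (fun m => ?_) hp.le_kappa hp.le_quarter hp.far ?_ hε htε hβ
  · have := hω 1 one_ne_zero m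
    simp only [Int.cast_one, abs_one, Real.one_rpow, div_one, one_mul] at this
    exact this.le
  · rw [Scale.interval, hlo, hhi, mem_Icc, ← abs_le] at ht
    exact ht

end Sizes

/-! ### Choice of the next scale -/

section Selection

variable {ω lam α : ℝ} {s : ℕ → Scale} {n : ℕ} {S T : Scale}

/-- No point of `T + j ω` lies in one of the translates `S + m ω` with `|m| ≤ M`. -/
def Avoids (ω : ℝ) (T S : Scale) (j : ℤ) : Prop :=
  ∀ m : ℤ, |m| ≤ S.M → ∀ θ ∈ translate ω T.arc j, θ ∉ translate ω S.arc m

/-- If a collision occurs at some j₀ < a + M, none occurs for j in [a + 4M, a + 5M). Two collisions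
would give a nonzero multiple of ω, of order at most 7M, within 2|S| of an integer. -/
theorem GapBound.exists_avoids (hS : GapBound ω S (7 * (S.M : ℤ)))
    (hTS : T.interval ⊆ S.interval) (a : ℤ) :
    ∃ b, a ≤ b ∧ b + S.M ≤ a + 5 * S.M ∧ ∀ j, b ≤ j → j < b + S.M → Avoids ω T S j := by
  by_cases h : ∀ j, a ≤ j → j < a + S.M → Avoids ω T S j
  · exact ⟨a, le_rfl, by omega, h⟩
  · simp only [Avoids, not_forall, not_not] at h
    obtain ⟨j₀, h1, h2, m₀, h3, θ₀, h4, h5⟩ := h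
    refine ⟨a + 4 * S.M, by omega, by omega, fun j hj hj' m hm θ hθ hθ' => ?_⟩
    obtain ⟨r, hr⟩ := exists_int_of_mem_translate hTS hθ' hθ
    obtain ⟨r₀, hr₀⟩ := exists_int_of_mem_translate hTS h5 h4
    rw [abs_le] at h3 hm
    have h6 := hS ((m - j) - (m₀ - j₀)) (r - r₀) (by omega) (by rw [abs_le]; constructor <;> omega)
    have h7 : (((m - j) - (m₀ - j₀) : ℤ) : ℝ) * ω - ((r - r₀ : ℤ) : ℝ) =
        (((m - j : ℤ) : ℝ) * ω - r) - (((m₀ - j₀ : ℤ) : ℝ) * ω - r₀) := by push_cast; ring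
    rw [h7] at h6
    have h8 := abs_sub (((m - j : ℤ) : ℝ) * ω - r) (((m₀ - j₀ : ℤ) : ℝ) * ω - r₀)
    linarith

/-- Descent through the scales: a run of M_i good times for I_i has room for the window of length
5M_{i-1} needed at scale i - 1. A run of 50 times survives at scale 0. -/
theorem Setting.exists_avoids (S : Setting ω lam α s n) (hT : T.interval ⊆ (s n).interval)
    (hM : ∀ k < n, 5 * (s k).M ≤ (s (k + 1)).M) {i : ℕ} (hi : i ≤ n) (a : ℤ) :
    ∃ b, a ≤ b ∧ b + 50 ≤ a + 5 * (s i).M ∧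
      ∀ j, b ≤ j → j < b + 50 → ∀ l ≤ i, Avoids ω T (s l) j := by
  induction i generalizing a with
  | zero =>
    have h1 := S.fifty_mul_K_le_M (Nat.zero_le n)
    have h2 := S.two_hundred_le_K (Nat.zero_le n)
    obtain ⟨b, hb, hb', h⟩ := (S.gap 0 hi).exists_avoids (hT.trans (S.nested 0 n hi le_rfl)) a
    refine ⟨b, hb, by omega, fun j hj hj' l hl => ?_⟩
    obtain rfl := Nat.le_zero.1 hl
    exact h j hj (by omega)
  | succ i ih =>
    have h1 := hM i hi
    obtain ⟨b, hb, hb', h⟩ :=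
      (S.gap (i + 1) hi).exists_avoids (hT.trans (S.nested (i + 1) n hi le_rfl)) a
    obtain ⟨b₁, hb₁, hb₁', h'⟩ := ih (Nat.le_of_succ_le hi) b
    refine ⟨b₁, by omega, by omega, fun j hj hj' l hl => ?_⟩
    rcases Nat.le_succ_iff.1 hl with hl | rfl
    · exact h' j hj hj' l hl
    · exact h j (by omega) (by omega)

theorem translate_subset_ΘPrev_of_avoids {j : ℤ} (h : ∀ l ≤ n, Avoids ω T (s l) j) :
    translate ω T.arc j ⊆ ΘPrev ω s (n + 1) := by
  intro θ hθ hθ'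
  obtain ⟨i, hi, hθ'⟩ := mem_iUnion₂.1 hθ'
  obtain ⟨m, hm, hmem⟩ := mem_iUnion₂.1 hθ'
  exact h i hi m (abs_le.2 hm) θ hθ hmem

end Selection

/-! ### Dependence on finitely many scales -/

section Congr

variable {ω lam α : ℝ} {s s' : ℕ → Scale} {n : ℕ}

theorem ΘPrev_congr (h : ∀ k ≤ n, s' k = s k) : ΘPrev ω s' n = ΘPrev ω s n := by
  cases n with
  | zero => simp only [ΘPrev, h 0 le_rfl]
  | succ n =>
    simp only [ΘPrev]
    congr 1
    refine iUnion₂_congr fun i hi => ?_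
    rw [h i (le_trans hi n.le_succ)]

theorem ΘPrev_succ_congr (h : ∀ k ≤ n, s' k = s k) : ΘPrev ω s' (n + 1) = ΘPrev ω s (n + 1) := by
  simp only [ΘPrev]
  congr 1
  refine iUnion₂_congr fun i hi => ?_
  rw [h i hi]

theorem GPrev_congr (h : ∀ k ≤ n, s' k = s k) : GPrev ω s' n = GPrev ω s n := by
  simp only [GPrev]
  refine iUnion₂_congr fun i hi => ?_
  rw [h i (le_of_lt hi)]

theorem PropsIToIII.congr (h : ∀ k ≤ n, s' k = s k) (hs : PropsIToIII ω lam α s n) :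
    PropsIToIII ω lam α s' n := by
  obtain ⟨⟨h1, h2⟩, h3, h4⟩ := hs
  refine ⟨⟨?_, ?_⟩, ?_, ?_⟩
  · simpa only [Contraction, ΘPrev_congr h, GPrev_congr h, h n le_rfl] using h1
  · simpa only [Return, ΘPrev_congr h, h n le_rfl] using h2
  · simpa only [PropII, GPrev_congr h, h n le_rfl, h 0 (Nat.zero_le n)] using h3
  · simpa only [PropIII, h n le_rfl] using h4

end Congr

/-! ### Construction of the scale n + 1 -/

section NextScale

variable {ω κ τ lam α : ℝ} {s : ℕ → Scale} {n : ℕ}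

theorem exists_next_scale (hs : Sizes ω τ lam α s n) (hp : LargeParameter κ τ lam)
    (S : Setting ω lam α s n) :
    ∃ s' : ℕ → Scale, (∀ k ≤ n, s' k = s k) ∧ Sizes ω τ lam α s' (n + 1) ∧
      Return ω s' (n + 1) ∧ IsStandardSucc ω α s' n := by
  set Kn := (s n).K with hKn
  set X := (5 / 4 : ℝ) ^ (Kn / (4 * τ) : ℝ) with hX
  have hLT := (hs.K_facts hp n le_rfl).2
  have hgrow : 20 * (Kn : ℝ) ^ 2 + 20 ≤ X := hLT.growth
  have hK200 : (200 : ℝ) ≤ Kn := by exact_mod_cast hLT.two_hundred_le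
  have hMn : ((s n).M : ℝ) ≤ 2 * (Kn : ℝ) ^ 2 := by exact_mod_cast (hs.M_facts hp le_rfl).2
  have hMgrow : ∀ k < n, 5 * (s k).M ≤ (s (k + 1)).M := by
    intro k hk
    have h1 := (hs.M_mem k hk).1
    rw [Sizes.rpow_half_eq] at h1
    have h2 := (hs.K_facts hp k hk.le).2.growth
    have h3 : ((s k).M : ℝ) ≤ 2 * ((s k).K : ℝ) ^ 2 := by exact_mod_cast (hs.M_facts hp hk.le).2
    have h4 : 5 * ((s k).M : ℝ) ≤ (s (k + 1)).M := by nlinarith [sq_nonneg ((s k).K : ℝ)]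
    exact_mod_cast h4
  set e : ℝ := (4 / 5 : ℝ) ^ Kn with he
  have he0 : 0 < e := by positivity
  -- Avoidance depends only on the interval of `T`, so the integers are placeholders until the
  -- search is over.
  let T : Scale := ⟨α - ω - e / 2, α - ω + e / 2, 0, 0⟩
  have hT : T.interval ⊆ (s n).interval :=
    (Icc_subset_Icc (by simp only [T]; linarith) (by simp only [T]; linarith)).trans hs.centre
  -- One window starts near 2X and provides 2K_{n+1}; the other lies near -X² and provides -M_{n+1}.
  -- Its length 5M_n ≤ 10K_n² is at most X/2, which fits the factor 2 allowed in the sizes.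
  obtain ⟨b, hb1, hb2, hb⟩ := S.exists_avoids hT hMgrow le_rfl (2 * (⌈X⌉₊ : ℤ) + 1)
  obtain ⟨d, hd1, hd2, hd⟩ := S.exists_avoids hT hMgrow le_rfl
    (-((⌈X ^ 2⌉₊ : ℤ) + 5 * (s n).M))
  -- By parity 2K' is b + 1 or b + 2, so all of 2K' - 1, …, 2K' + 21 lie in the run of 50 times.
  obtain ⟨K', hK'⟩ : ∃ K' : ℕ, (K' : ℤ) = (b + 2) / 2 :=
    ⟨((b + 2) / 2).toNat, Int.toNat_of_nonneg (by omega)⟩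
  obtain ⟨M', hM'⟩ : ∃ M' : ℕ, (M' : ℤ) = -d := ⟨(-d).toNat, Int.toNat_of_nonneg (by omega)⟩
  have hceil := Nat.le_ceil X
  have hceil' := Nat.ceil_lt_add_one (show 0 ≤ X by positivity)
  have hceil2 := Nat.le_ceil (X ^ 2)
  have hceil2' := Nat.ceil_lt_add_one (show 0 ≤ X ^ 2 by positivity)
  have hK1 : X ≤ K' := by
    have : ⌈X⌉₊ ≤ K' := by omega
    exact hceil.trans (Nat.cast_le.2 this)
  have hK2 : (K' : ℝ) ≤ 2 * X := by
    have h1 : 2 * K' ≤ 2 * ⌈X⌉₊ + 5 * (s n).M := by omega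
    have h2 : 2 * (K' : ℝ) ≤ 2 * (⌈X⌉₊ : ℝ) + 5 * ((s n).M : ℝ) := by exact_mod_cast h1
    linarith
  have hM1 : X ^ 2 ≤ M' := by
    have : ⌈X ^ 2⌉₊ ≤ M' := by omega
    exact hceil2.trans (Nat.cast_le.2 this)
  have hXX : X ≤ X ^ 2 := by nlinarith
  have hM2 : (M' : ℝ) ≤ 2 * X ^ 2 := by
    have h1 : M' ≤ ⌈X ^ 2⌉₊ + 5 * (s n).M := by omega
    have h2 : (M' : ℝ) ≤ (⌈X ^ 2⌉₊ : ℝ) + 5 * ((s n).M : ℝ) := by exact_mod_cast h1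
    linarith
  let T' : Scale := ⟨α - ω - e / 2, α - ω + e / 2, M', K'⟩
  let s' : ℕ → Scale := Function.update s (n + 1) T'
  have hs' : ∀ k ≤ n, s' k = s k := fun k hk => Function.update_of_ne (by omega) _ _
  have hsT : s' (n + 1) = T' := Function.update_self _ _ _
  have cases_lt : ∀ {P : ℕ → Prop}, (∀ k < n, P k) → P n → ∀ k < n + 1, P k := by
    intro P h1 h2 k hk
    rcases Nat.lt_succ_iff_lt_or_eq.1 hk with h | rfl
    · exact h1 k h
    · exact h2
  have hwide : ∀ m ∈ Icc (-1 : ℤ) 21,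
      translate ω T'.arc (2 * (K' : ℤ) + m) ⊆ ΘPrev ω s' (n + 1) := by
    intro m hm
    have hm1 := hm.1
    have hm2 := hm.2
    rw [ΘPrev_succ_congr hs']
    exact translate_subset_ΘPrev_of_avoids (T := T) (hb _ (by omega) (by omega))
  refine ⟨s', hs', ?_, ⟨fun m hm => ?_, ?_⟩, ?_⟩
  · refine ⟨by rw [hs' 0 (Nat.zero_le n), hs.zero], ?_, ?_, ?_, ?_, ?_, ?_, ?_⟩
    · refine cases_lt (fun k hk => ?_) ?_
      · rw [hs' _ hk, hs' _ hk.le]; exact hs.nested k hk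
      · rw [hsT, hs' _ le_rfl]; exact hT
    · refine cases_lt (fun k hk => ?_) ?_
      · rw [hs' _ hk, hs' _ hk.le]; exact hs.M_lt k hk
      · rw [hsT, hs' _ le_rfl]
        have : ((s n).M : ℝ) < M' := by nlinarith
        exact_mod_cast this
    · refine cases_lt (fun k hk => ?_) ?_
      · rw [hs' _ hk, hs' _ hk.le]; exact hs.K_lt k hk
      · rw [hsT, hs' _ le_rfl]
        have : (Kn : ℝ) < K' := by nlinarith
        exact_mod_cast this
    · refine cases_lt (fun k hk => ?_) ?_
      · rw [hs' _ hk, hs' _ hk.le]; exact hs.length k hk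
      · rw [hsT, hs' _ le_rfl]; simp only [T']; ring
    · refine cases_lt (fun k hk => ?_) ?_
      · rw [hs' _ hk, hs' _ hk.le]; exact hs.K_mem k hk
      · rw [hsT, hs' _ le_rfl]; exact ⟨hK1, hK2⟩
    · refine cases_lt (fun k hk => ?_) ?_
      · rw [hs' _ hk, hs' _ hk.le]; exact hs.M_mem k hk
      · rw [hsT, hs' _ le_rfl, Sizes.rpow_half_eq]; exact ⟨hM1, hM2⟩
    · rw [hsT]
      -- Four extra factors suffice because (4/5)^4 < 1/2.
      have h1 : Kn + 4 ≤ K' := by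
        have : (Kn : ℝ) + 4 ≤ K' := by nlinarith
        exact_mod_cast this
      have h2 : (4 / 5 : ℝ) ^ K' ≤ e / 2 := by
        refine (pow_le_pow_of_le_one (by norm_num) (by norm_num) h1).trans ?_
        rw [pow_add, ← he]
        nlinarith
      exact Icc_subset_Icc (by simp only [T']; linarith) (by simp only [T']; linarith)
  · rw [hsT]
    exact hwide m ⟨by linarith [hm.1], by linarith [hm.2]⟩
  · rw [hsT, ΘPrev_succ_congr hs']
    exact translate_subset_ΘPrev_of_avoids (T := T)
      (hd _ (by simp only [T']; omega) (by simp only [T']; omega))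
  · refine ⟨by rw [hsT, hs' _ le_rfl], by rw [hsT, hs' _ le_rfl], ?_⟩
    rw [hsT]; exact hwide

end NextScale

end ForcedLogistic

open ForcedLogistic
theorem mainTheorem2 (ω κ τ : ℝ) (hκ : 0 < κ) (hτ : 1 ≤ τ) (hω : Diophantine ω κ τ) :
    ∃ lam₁ : ℝ, 0 < lam₁ ∧ ∀ lam : ℝ, lam₁ ≤ lam → ∀ α ∈ A₀ ω lam,
      ∀ (n : ℕ) (s : ℕ → Scale), Sizes ω τ lam α s n → PropsIToIII ω lam α s n →
        (∃ s' : ℕ → Scale, (∀ k ≤ n, s' k = s k) ∧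
          Sizes ω τ lam α s' (n + 1) ∧ PropsIToIII ω lam α s' (n + 1) ∧
          IsStandardSucc ω α s' n) ∧
        ((∀ k < n, PropsIToIII ω lam α s k ∧ IsStandardSucc ω α s k) →
          PropIV ω lam α s n) := by
  obtain ⟨lam₁, h⟩ := Filter.eventually_atTop.1 (eventually_largeParameter hκ hτ)
  refine ⟨max lam₁ 1, by positivity, fun lam hlam α hα n s hs hprops => ?_⟩
  have hp := h lam ((le_max_left _ _).trans hlam)
  have S := hs.setting hp hκ hτ hω hα
  refine ⟨?_, propIV_of_scales S hprops⟩
  obtain ⟨s', hs', hsizes, hret, hstd⟩ := exists_next_scale hs hp S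
  have S' := hsizes.setting hp hκ hτ hω hα
  have hprops' := hprops.congr hs'
  exact ⟨s', hs', hsizes, ⟨⟨contraction_succ S' hprops' hstd, hret⟩,
    propII_succ S' hprops' hstd, propIII_succ S' hprops' hstd⟩, hstd⟩
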